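/- Let $N\in\mathbb{N}\cup\{\infty\}$ and let $A,B$ be row-finite $N\times N$ matrices with integer entries and no identically zero row, such that $A_{i,j}\ge 0$ for all $i,j$, and $B_{i,j}=0$ whenever $A_{i,j}=0$. If $N=\infty$, assume also that $A$ has no identically zero column. Let $E$ be the directed graph with vertex set $E^0=\{1,\dots,N\}$ ($E^0=\mathbb{N}$ if $N=\infty$) and edges $e_{i,j,n}$, $0\le n<A_{i,j}$, with source $s(e_{i,j,n})=i$ and range $r(e_{i,j,n})=j$. Let $E^n$ be the set of paths $\alpha=\alpha_1\cdots\alpha_n$ of length $|\alpha|=n$, where $r(\alpha_i)=s(\alpha_{i+1})$ (with $E^0$ the set of paths of length zero), let $E^\infty$ be the space of infinite paths with the topology induced from the product of discrete spaces, and let $Z(\alpha)=\{\alpha y: y\in E^\infty,\ s(y)=r(\alpha)\}$. For $m\in\mathbb{Z}$ and an edge $e=e_{i,j,n}$, write $mB_{i,j}+n=kA_{i,j}+l$ with $k,l\in\mathbb{Z}$, $0\le l<A_{i,j}$, and put $\kappa_m(e)=e_{i,j,l}$, $\varphi(m,e)=k$; extend $\kappa$ to infinite paths by $\kappa_m(ex)=\kappa_m(e)\,\kappa_{\varphi(m,e)}(x)$.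 Assume that the pair $A,B$ is pseudo free: if $\kappa_m(e)=e$ and $\varphi(m,e)=0$ for some edge $e$, then $m=0$. Let $\mathcal{G}_{A,B}$ be the étale groupoid of classes $[\alpha,m,\beta;x]$, where $\alpha,\beta$ are finite paths with $r(\alpha)=r(\beta)$, $m\in\mathbb{Z}$ and $x\in Z(\beta)$, under the equivalence relation generated by $(\alpha,m,\beta;x)\sim(\alpha\kappa_m(\gamma),\varphi(m,\gamma),\beta\gamma;x)$ for edges $\gamma$ with $s(\gamma)=r(\beta)$ and $x\in Z(\beta\gamma)$. Its unit space is $E^\infty$, with $s([\alpha,m,\beta;\beta y])=\beta y$ and $r([\alpha,m,\beta;\beta y])=\alpha\kappa_m(y)$; its product and inverse are $$[\alpha,m',\beta;\beta\kappa_m(y)]\cdot[\beta,m,\gamma;\gamma y]=[\alpha,m'+m,\gamma;\gamma y],\qquad [\alpha,m,\beta;\beta y]^{-1}=[\beta,-m,\alpha;\alpha\kappa_m(y)],$$ and its topology has as a basis the sets $Z(\alpha,m,\beta;Z(\beta))=\{[\alpha,m,\beta;x]:x\in Z(\beta)\}$. Let $\mathcal{H}_{A,B}$ be the kernel of the homomorphism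 $\rho:\mathcal{G}_{A,B}\to\mathbb{Z}$, $[\alpha,m,\beta;x]\mapsto|\alpha|-|\beta|$. For an étale groupoid $\mathcal{G}$, let $H_1(\mathcal{G})=\ker\delta_1/\operatorname{im}\delta_2$, where $\delta_1=s_*-r_*:C_c(\mathcal{G},\mathbb{Z})\to C_c(\mathcal{G}^{(0)},\mathbb{Z})$ and $\delta_2=d_{0*}-d_{1*}+d_{2*}:C_c(\mathcal{G}^{(2)},\mathbb{Z})\to C_c(\mathcal{G},\mathbb{Z})$, with $\mathcal{G}^{(2)}$ the space of composable pairs, $d_0(g,h)=h$, $d_1(g,h)=gh$, $d_2(g,h)=g$, and $\pi_*f(y)=\sum_{\pi(x)=y}f(x)$. Let $\mathbb{Z}_B$ be the inductive limit of the sequence $\mathbb{Z}^{(E^0)}\to\mathbb{Z}^{(E^0)}\to\cdots$ of free abelian groups on $E^0$, indexed by $n=0,1,2,\dots$, in which every map is $\mathbf{1}_v\mapsto\sum_w B_{v,w}\mathbf{1}_w$, and let $\varphi^B_{n,\infty}:\mathbb{Z}^{(E^0)}\to\mathbb{Z}_B$ be the canonical map from stage $n$. Then, for every $n\ge 0$ and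 every $\alpha\in E^n$, the function $\mathbf{1}_{Z(\alpha,1,\alpha;Z(\alpha))}$ belongs to $C_c(\mathcal{H}_{A,B},\mathbb{Z})$ and is a $1$-cycle, and there is a unique group isomorphism $\Phi_B:H_1(\mathcal{H}_{A,B})\to\mathbb{Z}_B$ such that $$\Phi_B\big([\mathbf{1}_{Z(\alpha,1,\alpha;Z(\alpha))}]\big)=\varphi^B_{n,\infty}(\mathbf{1}_{r(\alpha)})\qquad\text{for all } n\ge 0,\ \alpha\in E^n.$$ -/

import Mathlib

open scoped CompactlySupported

/-! ### Étale groupoids and their first homology group -/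

/-- An étale groupoid with space of arrows `G` and unit space `X`, with source map `s`, range
map `r`, and partially defined product `mul g h` for `s g = r h`. Continuity of `r`, and the fact
that `r` is a local homeomorphism, follow from `r = s ∘ inv`. -/
structure EtaleGroupoid (G X : Type*) [TopologicalSpace G] [TopologicalSpace X] where
  s : G → X
  r : G → X
  one : X → G
  mul : (g h : G) → s g = r h → G
  inv : G → G
  s_one : ∀ x, s (one x) = x
  r_one : ∀ x, r (one x) = x
  s_mul : ∀ g h c, s (mul g h c) = s h
  r_mul : ∀ g h c, r (mul g h c) = r g
  s_inv : ∀ g, s (inv g) = r g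
  r_inv : ∀ g, r (inv g) = s g
  one_mul : ∀ g, mul (one (r g)) g (s_one _) = g
  mul_one : ∀ g, mul g (one (s g)) (r_one _).symm = g
  mul_assoc : ∀ g h k (c : s g = r h) (d : s h = r k),
    mul (mul g h c) k ((s_mul g h c).trans d) = mul g (mul h k d) (c.trans (r_mul h k d).symm)
  inv_mul : ∀ g, mul (inv g) g (s_inv g) = one (s g)
  mul_inv : ∀ g, mul g (inv g) (r_inv g).symm = one (r g)
  continuous_one : Continuous one
  continuous_inv : Continuous inv
  continuous_mul : Continuous fun p : {p : G × G // s p.1 = r p.2} => mul p.1.1 p.1.2 p.2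
  isLocalHomeomorph_s : IsLocalHomeomorph s

section Pushforward

variable {X Y : Type*} [TopologicalSpace X]

/-- A compactly supported function meets each fibre of a locally injective map in a finite set. -/
theorem finite_support_fibre {π : X → Y} (hπ : IsLocallyInjective π) (f : C_c(X, ℤ)) (y : Y) :
    (Function.support fun x : {x : X // π x = y} => f x).Finite := by
  have hcov := hπ
  choose U hU hxU hinj using hcov
  obtain ⟨t, ht⟩ := f.hasCompactSupport.isCompact.elim_finite_subcover U hU
    (fun x _ => Set.mem_iUnion.2 ⟨x, hxU x⟩)
  have hsub : (Function.support fun x : {x : X // π x = y} => f x) ⊆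
      ⋃ i ∈ t, {x : {x : X // π x = y} | (x : X) ∈ U i} := by
    intro x hx
    have h1 : (x : X) ∈ tsupport f := subset_tsupport _ hx
    simpa using ht h1
  refine Set.Finite.subset (t.finite_toSet.biUnion fun i _ => ?_) hsub
  refine Set.Subsingleton.finite ?_
  intro a ha b hb
  exact Subtype.ext (hinj i ha hb (a.2.trans b.2.symm))

/-- The pushforward `π_* f (y) = ∑_{π x = y} f x`; the sum has finitely many nonzero terms. -/
noncomputable def pushforward (π : X → Y) (hπ : IsLocallyInjective π) : C_c(X, ℤ) →+ (Y → ℤ) where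
  toFun f y := ∑ᶠ x : {x : X // π x = y}, f x
  map_zero' := by ext y; simp
  map_add' f g := by
    ext y
    exact finsum_add_distrib (finite_support_fibre hπ f y) (finite_support_fibre hπ g y)

end Pushforward

namespace EtaleGroupoid

variable {G X : Type*} [TopologicalSpace G] [TopologicalSpace X] (𝒢 : EtaleGroupoid G X)

/-- The space of composable pairs. -/
abbrev Pairs : Type _ := {p : G × G // 𝒢.s p.1 = 𝒢.r p.2}

def d₀ (p : 𝒢.Pairs) : G := p.1.2

def d₁ (p : 𝒢.Pairs) : G := 𝒢.mul p.1.1 p.1.2 p.2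

def d₂ (p : 𝒢.Pairs) : G := p.1.1

theorem locInj_s : IsLocallyInjective 𝒢.s := 𝒢.isLocalHomeomorph_s.isLocallyInjective

theorem inv_inv (g : G) : 𝒢.inv (𝒢.inv g) = g := by
  have h1 := 𝒢.mul_assoc (𝒢.inv (𝒢.inv g)) (𝒢.inv g) g (𝒢.s_inv _) (𝒢.s_inv _)
  have key : ∀ (a b : G) (c) (b' : G) (hb : b = b'), 𝒢.mul a b c = 𝒢.mul a b' (hb ▸ c) := by
    rintro a b c b' rfl; rfl
  have key' : ∀ (a b : G) (c) (a' : G) (ha : a = a'), 𝒢.mul a b c = 𝒢.mul a' b (ha ▸ c) := by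
    rintro a b c b' rfl; rfl
  have hs : 𝒢.s (𝒢.inv (𝒢.inv g)) = 𝒢.s g := by rw [𝒢.s_inv, 𝒢.r_inv]
  have hs' : 𝒢.s (𝒢.inv g) = 𝒢.r g := 𝒢.s_inv g
  rw [key' _ g _ _ (𝒢.inv_mul (𝒢.inv g)), key _ _ _ _ (𝒢.inv_mul g),
    key' _ g _ (𝒢.one (𝒢.r g)) (by rw [hs']), 𝒢.one_mul,
    key _ _ _ (𝒢.one (𝒢.s (𝒢.inv (𝒢.inv g)))) (by rw [hs]), 𝒢.mul_one] at h1
  exact h1.symm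

theorem locInj_r : IsLocallyInjective 𝒢.r := by
  intro g
  obtain ⟨U, hU, hg, hinj⟩ := 𝒢.locInj_s (𝒢.inv g)
  refine ⟨𝒢.inv ⁻¹' U, hU.preimage 𝒢.continuous_inv, hg, ?_⟩
  intro a ha b hb hab
  have := hinj ha hb (by rw [𝒢.s_inv, 𝒢.s_inv, hab])
  rw [← 𝒢.inv_inv a, this, 𝒢.inv_inv]

theorem locInj_d₀ : IsLocallyInjective 𝒢.d₀ := by
  rintro ⟨⟨g, h⟩, c⟩
  obtain ⟨U, hU, hg, hinj⟩ := 𝒢.locInj_s g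
  refine ⟨{p | p.1.1 ∈ U}, hU.preimage (by fun_prop), hg, ?_⟩
  rintro ⟨⟨a, b⟩, c⟩ ha ⟨⟨a', b'⟩, c'⟩ ha' (hb : b = b')
  subst hb
  have : a = a' := hinj ha ha' (c.trans c'.symm)
  subst this
  rfl

theorem locInj_d₂ : IsLocallyInjective 𝒢.d₂ := by
  rintro ⟨⟨g, h⟩, c⟩
  obtain ⟨U, hU, hg, hinj⟩ := 𝒢.locInj_r h
  refine ⟨{p | p.1.2 ∈ U}, hU.preimage (by fun_prop), hg, ?_⟩
  rintro ⟨⟨a, b⟩, c⟩ ha ⟨⟨a', b'⟩, c'⟩ ha' (hb : a = a')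
  subst hb
  have : b = b' := hinj ha ha' (c.symm.trans c')
  subst this
  rfl

theorem locInj_d₁ : IsLocallyInjective 𝒢.d₁ := by
  rintro ⟨⟨g, h⟩, c⟩
  obtain ⟨U, hU, hg, hinj⟩ := 𝒢.locInj_r g
  obtain ⟨W, hW, hh, hinjW⟩ := 𝒢.locInj_s h
  refine ⟨{p | p.1.1 ∈ U ∧ p.1.2 ∈ W}, (hU.preimage (by fun_prop)).inter
    (hW.preimage (by fun_prop)), ⟨hg, hh⟩, ?_⟩
  rintro ⟨⟨a, b⟩, c⟩ ⟨ha, hb⟩ ⟨⟨a', b'⟩, c'⟩ ⟨ha', hb'⟩ (hm : 𝒢.mul a b c = 𝒢.mul a' b' c')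
  have h1 : a = a' := hinj ha ha' (by rw [← 𝒢.r_mul a b c, hm, 𝒢.r_mul])
  have h2 : b = b' := hinjW hb hb' (by rw [← 𝒢.s_mul a b c, hm, 𝒢.s_mul])
  subst h1 h2
  rfl

/-- `δ₁ = s_* - r_*`. -/
noncomputable def δ₁ : C_c(G, ℤ) →+ (X → ℤ) :=
  pushforward 𝒢.s 𝒢.locInj_s - pushforward 𝒢.r 𝒢.locInj_r

/-- `δ₂ = d₀_* - d₁_* + d₂_*`. -/
noncomputable def δ₂ : C_c(𝒢.Pairs, ℤ) →+ (G → ℤ) :=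
  pushforward 𝒢.d₀ 𝒢.locInj_d₀ - pushforward 𝒢.d₁ 𝒢.locInj_d₁ + pushforward 𝒢.d₂ 𝒢.locInj_d₂

/-- The group of 1-cycles `ker δ₁`. -/
noncomputable def cycles₁ : AddSubgroup C_c(G, ℤ) := 𝒢.δ₁.ker

/-- The 1-boundaries: those 1-cycles which, as functions, are of the form `δ₂ h`. -/
noncomputable def boundaries₁ : AddSubgroup 𝒢.cycles₁ where
  carrier := {z | ∃ h : C_c(𝒢.Pairs, ℤ), 𝒢.δ₂ h = ⇑(z : C_c(G, ℤ))}
  zero_mem' := ⟨0, by simp⟩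
  add_mem' := by
    rintro a b ⟨h, hh⟩ ⟨k, hk⟩
    exact ⟨h + k, by simp [hh, hk]⟩
  neg_mem' := by
    rintro a ⟨h, hh⟩
    exact ⟨-h, by simp [hh]⟩

/-- The first homology group `H₁ = ker δ₁ / im δ₂`. -/
abbrev H₁ : Type _ := 𝒢.cycles₁ ⧸ 𝒢.boundaries₁

/-- The homology class of a 1-cycle. -/
noncomputable def homologyClass (z : 𝒢.cycles₁) : 𝒢.H₁ := QuotientAddGroup.mk z

/-- The kernel of a continuous groupoid homomorphism `ρ : G → ℤ`, an open subgroupoid with the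
same unit space. -/
def ker (ρ : G → ℤ) (hmul : ∀ g h c, ρ (𝒢.mul g h c) = ρ g + ρ h) (hρ : Continuous ρ) :
    EtaleGroupoid {g : G // ρ g = 0} X :=
  have hone : ∀ x, ρ (𝒢.one x) = 0 := fun x => by
    have h1 := hmul (𝒢.one (𝒢.r (𝒢.one x))) (𝒢.one x) (𝒢.s_one _)
    rw [𝒢.one_mul, 𝒢.r_one] at h1
    linarith
  have hinv : ∀ g, ρ g = 0 → ρ (𝒢.inv g) = 0 := fun g hg => by
    have h1 := hmul (𝒢.inv g) g (𝒢.s_inv g)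
    rw [𝒢.inv_mul, hone, hg] at h1
    linarith
  { s := fun g => 𝒢.s g.1
    r := fun g => 𝒢.r g.1
    one := fun x => ⟨𝒢.one x, hone x⟩
    mul := fun g h c => ⟨𝒢.mul g.1 h.1 c, by rw [hmul, g.2, h.2, add_zero]⟩
    inv := fun g => ⟨𝒢.inv g.1, hinv g.1 g.2⟩
    s_one := fun x => 𝒢.s_one x
    r_one := fun x => 𝒢.r_one x
    s_mul := fun g h c => 𝒢.s_mul g.1 h.1 c
    r_mul := fun g h c => 𝒢.r_mul g.1 h.1 c
    s_inv := fun g => 𝒢.s_inv g.1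
    r_inv := fun g => 𝒢.r_inv g.1
    one_mul := fun g => Subtype.ext (𝒢.one_mul g.1)
    mul_one := fun g => Subtype.ext (𝒢.mul_one g.1)
    mul_assoc := fun g h k c d => Subtype.ext (𝒢.mul_assoc g.1 h.1 k.1 c d)
    inv_mul := fun g => Subtype.ext (𝒢.inv_mul g.1)
    mul_inv := fun g => Subtype.ext (𝒢.mul_inv g.1)
    continuous_one := 𝒢.continuous_one.subtype_mk _
    continuous_inv := (𝒢.continuous_inv.comp continuous_subtype_val).subtype_mk _
    continuous_mul := by
      refine Continuous.subtype_mk (𝒢.continuous_mul.comp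
        (f := fun p : {p : {g : G // ρ g = 0} × {g : G // ρ g = 0} //
          𝒢.s p.1.1 = 𝒢.r p.2.1} => (⟨(p.1.1.1, p.1.2.1), p.2⟩ :
            {p : G × G // 𝒢.s p.1 = 𝒢.r p.2})) ?_) _
      fun_prop
    isLocalHomeomorph_s := 𝒢.isLocalHomeomorph_s.comp
      ((isOpen_discrete ({0} : Set ℤ)).preimage hρ).isOpenEmbedding_subtypeVal.isLocalHomeomorph }

end EtaleGroupoid

/-! ### The graph of `A`, the action `κ` and the cocycle `φ` -/

namespace Katsura

variable {V : Type*}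

/-- The edges `e_{i,j,n}`, `0 ≤ n < A i j`, from `i` to `j`. -/
@[ext]
structure Edge (A : Matrix V V ℤ) where
  src : V
  tgt : V
  idx : ℤ
  idx_nonneg : 0 ≤ idx
  idx_lt : idx < A src tgt

variable {A : Matrix V V ℤ} (B : Matrix V V ℤ)

theorem Edge.pos (e : Edge A) : 0 < A e.src e.tgt := e.idx_nonneg.trans_lt e.idx_lt

/-- `κ_m(e_{i,j,n}) = e_{i,j,l}`, where `m B_{i,j} + n = k A_{i,j} + l` and `0 ≤ l < A_{i,j}`. -/
@[simps]
def Edge.act (m : ℤ) (e : Edge A) : Edge A where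
  src := e.src
  tgt := e.tgt
  idx := (m * B e.src e.tgt + e.idx) % A e.src e.tgt
  idx_nonneg := Int.emod_nonneg _ e.pos.ne'
  idx_lt := Int.emod_lt_of_pos _ e.pos

/-- `φ(m, e_{i,j,n}) = k`, where `m B_{i,j} + n = k A_{i,j} + l` and `0 ≤ l < A_{i,j}`. -/
def Edge.cocycle (m : ℤ) (e : Edge A) : ℤ := (m * B e.src e.tgt + e.idx) / A e.src e.tgt

theorem Edge.act_zero (e : Edge A) : e.act B 0 = e := by
  ext <;> simp [Int.emod_eq_of_lt e.idx_nonneg e.idx_lt]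

theorem Edge.cocycle_zero (e : Edge A) : e.cocycle B 0 = 0 := by
  simp [Edge.cocycle, Int.ediv_eq_zero_of_lt e.idx_nonneg e.idx_lt]

theorem Edge.act_add (m m' : ℤ) (e : Edge A) :
    e.act B (m + m') = (e.act B m').act B m := by
  ext
  · rfl
  · rfl
  · simp only [Edge.act_idx, Edge.act_src, Edge.act_tgt, Int.add_emod_emod]
    ring_nf

theorem Edge.cocycle_add (m m' : ℤ) (e : Edge A) :
    e.cocycle B (m + m') = (e.act B m').cocycle B m + e.cocycle B m' := by
  simp only [Edge.cocycle, Edge.act_idx, Edge.act_src, Edge.act_tgt]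
  have h := Int.emod_add_mul_ediv (m' * B e.src e.tgt + e.idx) (A e.src e.tgt)
  have h2 : (m + m') * B e.src e.tgt + e.idx =
      (m * B e.src e.tgt + (m' * B e.src e.tgt + e.idx) % A e.src e.tgt) +
        A e.src e.tgt * ((m' * B e.src e.tgt + e.idx) / A e.src e.tgt) := by
    linear_combination -h
  rw [h2, Int.add_mul_ediv_left _ _ e.pos.ne']

/-- The pair `A`, `B` is pseudo free. -/
def PseudoFree (A B : Matrix V V ℤ) : Prop :=
  ∀ (m : ℤ) (e : Edge A), e.act B m = e → e.cocycle B m = 0 → m = 0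

/-- Row-finiteness; for integer entries, `∑_j |A i j| < ∞` says that row `i` is finitely
supported. -/
def RowFinite (A : Matrix V V ℤ) : Prop := ∀ i, (Function.support (A i)).Finite

/-! ### Finite and infinite paths -/

/-- `IsWalk v l w`: the list of edges `l` is a path from `v` to `w`. -/
def IsWalk : V → List (Edge A) → V → Prop
  | v, [], w => v = w
  | v, e :: l, w => v = e.src ∧ IsWalk e.tgt l w

theorem IsWalk.concat {v w : V} {l : List (Edge A)} (h : IsWalk v l w) (e : Edge A)
    (he : e.src = w) : IsWalk v (l ++ [e]) e.tgt := by
  induction l generalizing v with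
  | nil => exact ⟨Eq.trans h he.symm, rfl⟩
  | cons f l ih => exact ⟨h.1, ih h.2⟩

variable (A) in
/-- Finite paths; the paths of length zero are the vertices. -/
@[ext]
structure FinPath where
  src : V
  tgt : V
  edges : List (Edge A)
  isWalk : IsWalk src edges tgt

namespace FinPath

/-- The vertex `v` as a path of length zero. -/
def vertex (A : Matrix V V ℤ) (v : V) : FinPath A := ⟨v, v, [], rfl⟩

def length (α : FinPath A) : ℕ := α.edges.length

/-- The path `α e`. -/
def snoc (α : FinPath A) (e : Edge A) (h : e.src = α.tgt) : FinPath A :=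
  ⟨α.src, e.tgt, α.edges ++ [e], α.isWalk.concat e h⟩

@[simp] theorem length_snoc (α : FinPath A) (e : Edge A) (h : e.src = α.tgt) :
    (α.snoc e h).length = α.length + 1 := by simp [length, snoc]

end FinPath

instance : TopologicalSpace (Edge A) := ⊥

instance : DiscreteTopology (Edge A) := ⟨rfl⟩

variable (A) in
/-- Infinite paths, with the topology induced by the product of discrete spaces. -/
abbrev InfPath : Type _ := {x : ℕ → Edge A // ∀ i, (x i).tgt = (x (i + 1)).src}

/-- The sequence consisting of the list `l` followed by the sequence `x`. -/
def prepend : List (Edge A) → (ℕ → Edge A) → ℕ → Edge A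
  | [], x, n => x n
  | e :: _, _, 0 => e
  | _ :: l, x, n + 1 => prepend l x n

theorem prepend_append (l l' : List (Edge A)) (x : ℕ → Edge A) :
    prepend (l ++ l') x = prepend l (prepend l' x) := by
  induction l with
  | nil => rfl
  | cons e l ih => funext n; cases n with
    | zero => rfl
    | succ n => simp [prepend, ih]

theorem prepend_add (l : List (Edge A)) (x : ℕ → Edge A) (n : ℕ) :
    prepend l x (l.length + n) = x n := by
  induction l with
  | nil => simp [prepend]
  | cons e l ih =>
    rw [List.length_cons, show l.length + 1 + n = (l.length + n) + 1 by omega]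
    exact ih

theorem prepend_eq_of_lt (l : List (Edge A)) (x y : ℕ → Edge A) (n : ℕ) (h : n < l.length) :
    prepend l x n = prepend l y n := by
  induction l generalizing n with
  | nil => simp at h
  | cons e l ih => cases n with
    | zero => rfl
    | succ n => exact ih n (by simpa using h)

theorem prepend_injective {l l' : List (Edge A)} (hl : l.length = l'.length) {x x' : ℕ → Edge A}
    (h : prepend l x = prepend l' x') : l = l' ∧ x = x' := by
  induction l generalizing l' with
  | nil => cases l' with
    | nil => exact ⟨rfl, h⟩
    | cons e l' => simp at hl
  | cons e l ih => cases l' with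
    | nil => simp at hl
    | cons e' l' =>
      have h0 : e = e' := congrFun h 0
      obtain ⟨h1, h2⟩ := ih (l' := l') (by simpa using hl) (funext fun n => congrFun h (n + 1))
      exact ⟨by rw [h0, h1], h2⟩

theorem prepend_isPath {v w : V} {l : List (Edge A)} (hl : IsWalk v l w) (y : InfPath A)
    (hy : (y.1 0).src = w) :
    (∀ i, (prepend l y.1 i).tgt = (prepend l y.1 (i + 1)).src) ∧ (prepend l y.1 0).src = v := by
  induction l generalizing v with
  | nil => exact ⟨y.2, hy.trans hl.symm⟩
  | cons e l ih =>
    obtain ⟨h1, h2⟩ := ih hl.2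
    refine ⟨fun i => ?_, hl.1.symm⟩
    cases i with
    | zero => exact h2.symm
    | succ i => exact h1 i

namespace InfPath

/-- The source of an infinite path. -/
def src (x : InfPath A) : V := (x.1 0).src

/-- The infinite path `x_{n+1} x_{n+2} ⋯` obtained by deleting the first `n` edges. -/
def drop (n : ℕ) (x : InfPath A) : InfPath A :=
  ⟨fun i => x.1 (n + i), fun i => x.2 (n + i)⟩

/-- The integers `m, φ(m, x₁), φ(m, x₁x₂), …`. -/
def carry (m : ℤ) (x : InfPath A) : ℕ → ℤ
  | 0 => m
  | n + 1 => (x.1 n).cocycle B (carry m x n)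

/-- The action `κ_m` on infinite paths, `κ_m(e x) = κ_m(e) κ_{φ(m,e)}(x)`. -/
def act (m : ℤ) (x : InfPath A) : InfPath A :=
  ⟨fun n => (x.1 n).act B (x.carry B m n), fun i => x.2 i⟩

@[simp] theorem src_act (m : ℤ) (x : InfPath A) : (x.act B m).src = x.src := rfl

theorem carry_add (m m' : ℤ) (x : InfPath A) (n : ℕ) :
    x.carry B (m + m') n = (x.act B m').carry B m n + x.carry B m' n := by
  induction n with
  | zero => rfl
  | succ n ih => simp only [carry, ih, Edge.cocycle_add]; rfl

theorem act_add (m m' : ℤ) (x : InfPath A) : x.act B (m + m') = (x.act B m').act B m := by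
  refine Subtype.ext (funext fun n => ?_)
  simp only [act, carry_add, Edge.act_add]

theorem carry_zero (x : InfPath A) (n : ℕ) : x.carry B 0 n = 0 := by
  induction n with
  | zero => rfl
  | succ n ih => simp [carry, ih, Edge.cocycle_zero]

theorem act_zero (x : InfPath A) : x.act B 0 = x := by
  refine Subtype.ext (funext fun n => ?_)
  simp [act, carry_zero, Edge.act_zero]

theorem carry_drop_one (m : ℤ) (x : InfPath A) (n : ℕ) :
    (x.drop 1).carry B ((x.1 0).cocycle B m) n = x.carry B m (n + 1) := by
  induction n with
  | zero => rfl
  | succ n ih =>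
    rw [carry, ih]
    change (x.1 (1 + n)).cocycle B _ = (x.1 (n + 1)).cocycle B _
    rw [add_comm 1 n]

theorem act_drop_one (m : ℤ) (x : InfPath A) :
    (x.drop 1).act B ((x.1 0).cocycle B m) = (x.act B m).drop 1 := by
  refine Subtype.ext (funext fun n => ?_)
  change (x.1 (1 + n)).act B ((x.drop 1).carry B _ n) = (x.1 (1 + n)).act B (x.carry B m (1 + n))
  rw [carry_drop_one, add_comm 1 n]

end InfPath

namespace FinPath

/-- The infinite path `α y`. -/
def concat (α : FinPath A) (y : InfPath A) (h : y.src = α.tgt) : InfPath A :=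
  ⟨prepend α.edges y.1, (prepend_isPath α.isWalk y h).1⟩

/-- The cylinder set `Z(α) = {α y : s(y) = r(α)}`. -/
def Z (α : FinPath A) : Set (InfPath A) := {x | ∃ y h, x = α.concat y h}

theorem drop_concat (α : FinPath A) (y : InfPath A) (h : y.src = α.tgt) :
    (α.concat y h).drop α.length = y :=
  Subtype.ext (funext fun n => prepend_add α.edges y.1 n)

theorem src_concat (α : FinPath A) (y : InfPath A) (h : y.src = α.tgt) :
    (α.concat y h).src = α.src := (prepend_isPath α.isWalk y h).2

theorem src_drop_of_mem {α : FinPath A} {x : InfPath A} (hx : x ∈ α.Z) :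
    (x.drop α.length).src = α.tgt := by
  obtain ⟨y, h, rfl⟩ := hx
  rw [drop_concat, h]

theorem src_apply_of_mem {α : FinPath A} {x : InfPath A} (hx : x ∈ α.Z) :
    (x.1 α.length).src = α.tgt := src_drop_of_mem hx

theorem concat_drop_of_mem {α : FinPath A} {x : InfPath A} (hx : x ∈ α.Z) :
    α.concat (x.drop α.length) (src_drop_of_mem hx) = x := by
  obtain ⟨y, h, rfl⟩ := hx
  simp only [drop_concat]

theorem concat_mem (α : FinPath A) (y : InfPath A) (h : y.src = α.tgt) : α.concat y h ∈ α.Z :=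
  ⟨y, h, rfl⟩

theorem eq_of_mem {α β : FinPath A} {x : InfPath A} (hα : x ∈ α.Z) (hβ : x ∈ β.Z)
    (hl : α.length = β.length) : α = β := by
  obtain ⟨y, h, rfl⟩ := hα
  obtain ⟨y', h', he⟩ := hβ
  obtain ⟨h1, h2⟩ := prepend_injective hl (congrArg Subtype.val he)
  have h3 : y = y' := Subtype.ext h2
  subst h3
  refine FinPath.ext ?_ (h.symm.trans h') h1
  rw [← α.src_concat y h, he, src_concat]

theorem mem_Z_iff {α : FinPath A} {x x' : InfPath A} (hx : x ∈ α.Z) :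
    x' ∈ α.Z ↔ x'.src = x.src ∧ ∀ i < α.length, x'.1 i = x.1 i := by
  constructor
  · intro hx'
    obtain ⟨y, h, rfl⟩ := hx
    obtain ⟨y', h', rfl⟩ := hx'
    exact ⟨by rw [src_concat, src_concat], fun i hi => prepend_eq_of_lt _ _ _ i hi⟩
  · rintro ⟨hs, he⟩
    have hsrc : (x'.drop α.length).src = α.tgt := by
      rw [← src_drop_of_mem hx]
      rcases hα : α.length with _ | n
      · exact hs
      · have h1 := x'.2 n
        have h2 := x.2 n
        rw [he n (by omega)] at h1
        exact h1.symm.trans h2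
    refine ⟨x'.drop α.length, hsrc, Subtype.ext (funext fun i => ?_)⟩
    rcases lt_or_ge i α.length with hi | hi
    · rw [he i hi, ← concat_drop_of_mem hx]
      exact prepend_eq_of_lt _ _ _ i hi
    · obtain ⟨k, rfl⟩ := Nat.exists_eq_add_of_le hi
      exact (prepend_add α.edges (x'.drop α.length).1 k).symm

theorem snoc_mem {α : FinPath A} {x : InfPath A} (hx : x ∈ α.Z) :
    x ∈ (α.snoc (x.1 α.length) (src_apply_of_mem hx)).Z := by
  refine ⟨(x.drop α.length).drop 1, ?_, ?_⟩
  · exact (x.2 α.length).symm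
  · conv_lhs => rw [← concat_drop_of_mem hx]
    refine Subtype.ext ?_
    change prepend α.edges _ = prepend (α.edges ++ [_]) _
    rw [prepend_append]
    congr 1
    funext n
    cases n with
    | zero => rfl
    | succ n => simp [prepend, InfPath.drop, add_comm 1 n]

theorem mem_of_snoc_mem {α : FinPath A} {e : Edge A} (h : e.src = α.tgt) {x : InfPath A}
    (hx : x ∈ (α.snoc e h).Z) : x ∈ α.Z ∧ x.1 α.length = e := by
  obtain ⟨y, hy, rfl⟩ := hx
  have hw : IsWalk e.src [e] e.tgt := ⟨rfl, rfl⟩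
  have h1 := prepend_isPath hw y hy
  have h2 : (α.snoc e h).concat y hy = α.concat ⟨prepend [e] y.1, h1.1⟩ (h1.2.trans h) :=
    Subtype.ext (prepend_append _ _ _)
  refine ⟨⟨_, _, h2⟩, ?_⟩
  rw [h2]
  exact prepend_add α.edges _ 0

theorem isOpen_Z (α : FinPath A) : IsOpen α.Z := by
  rw [isOpen_iff_forall_mem_open]
  intro x hx
  refine ⟨{x' | ∀ i < α.length + 1, x'.1 i = x.1 i}, ?_, ?_, fun i _ => rfl⟩
  · intro x' hx'
    refine (mem_Z_iff hx).2 ⟨?_, fun i hi => hx' i (by omega)⟩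
    exact congrArg Edge.src (hx' 0 (by omega))
  · exact (PiNat.isOpen_cylinder (fun _ => Edge A) x.1 (α.length + 1)).preimage
      continuous_subtype_val

end FinPath

theorem InfPath.exists_cylinder {U : Set (InfPath A)} (hU : IsOpen U) {x : InfPath A}
    (hx : x ∈ U) : ∃ n, ∀ x' : InfPath A, (∀ i < n, x'.1 i = x.1 i) → x' ∈ U := by
  obtain ⟨W, hW, rfl⟩ := hU
  obtain ⟨_, ⟨z, n, rfl⟩, hz, hsub⟩ :=
    (PiNat.isTopologicalBasis_cylinders (fun _ => Edge A)).exists_subset_of_mem_open hx hW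
  exact ⟨n, fun x' h => hsub fun i hi => (h i hi).trans (hz i hi)⟩

/-! ### The Katsura–Exel–Pardo groupoid -/

variable (A) in
/-- The triples `(α, m, β)` with `r(α) = r(β)`. -/
@[ext]
structure Triple where
  α : FinPath A
  m : ℤ
  β : FinPath A
  tgt_eq : α.tgt = β.tgt

/-- The triple `(α κ_m(γ), φ(m,γ), β γ)`. -/
def Triple.snoc (t : Triple A) (γ : Edge A) (h : γ.src = t.β.tgt) : Triple A where
  α := t.α.snoc (γ.act B t.m) (h.trans t.tgt_eq.symm)
  m := γ.cocycle B t.m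
  β := t.β.snoc γ h
  tgt_eq := rfl

variable (A) in
/-- The quadruples `(α, m, β; x)` with `x ∈ Z(β)`. -/
@[ext]
structure Quad where
  t : Triple A
  x : InfPath A
  mem : x ∈ t.β.Z

/-- The relation `(α, m, β; x) ∼ (α κ_m(γ), φ(m,γ), β γ; x)`, where `γ` is an edge with
`s(γ) = r(β)` and `x ∈ Z(β γ)`. -/
def Step (q q' : Quad A) : Prop :=
  q'.x = q.x ∧ ∃ γ h, q'.t = q.t.snoc B γ h

/-- The set of arrows `[α, m, β; x]`: the quotient by the equivalence relation generated by
`Step`. -/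
def Arrow (A B : Matrix V V ℤ) : Type _ := Quot (Step B : Quad A → Quad A → Prop)

namespace Quad

/-- The arrow `[α, m, β; x]`. -/
def mk' (q : Quad A) : Arrow A B := Quot.mk _ q

theorem src_act_drop (q : Quad A) :
    ((q.x.drop q.t.β.length).act B q.t.m).src = q.t.α.tgt :=
  (FinPath.src_drop_of_mem q.mem).trans q.t.tgt_eq.symm

/-- The range `α κ_m(y)` of `[α, m, β; β y]`. -/
def rng (q : Quad A) : InfPath A :=
  q.t.α.concat ((q.x.drop q.t.β.length).act B q.t.m) (q.src_act_drop B)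

theorem rng_mem (q : Quad A) : q.rng B ∈ q.t.α.Z := FinPath.concat_mem _ _ _

theorem drop_rng (q : Quad A) :
    (q.rng B).drop q.t.α.length = (q.x.drop q.t.β.length).act B q.t.m :=
  FinPath.drop_concat _ _ _

theorem rng_apply (q : Quad A) :
    (q.rng B).1 q.t.α.length = (q.x.1 q.t.β.length).act B q.t.m :=
  congrArg (fun y : InfPath A => y.1 0) (q.drop_rng B)

/-- The quadruple related to `q` by `Step`. -/
def next (q : Quad A) : Quad A :=
  ⟨q.t.snoc B (q.x.1 q.t.β.length) (FinPath.src_apply_of_mem q.mem), q.x, FinPath.snoc_mem q.mem⟩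

@[simp] theorem next_α_length (q : Quad A) : (q.next B).t.α.length = q.t.α.length + 1 :=
  FinPath.length_snoc _ ((q.x.1 q.t.β.length).act B q.t.m)
    ((FinPath.src_apply_of_mem q.mem).trans q.t.tgt_eq.symm)

@[simp] theorem next_β_length (q : Quad A) : (q.next B).t.β.length = q.t.β.length + 1 :=
  FinPath.length_snoc _ _ (FinPath.src_apply_of_mem q.mem)

theorem step_next (q : Quad A) : Step B q (q.next B) := ⟨rfl, _, _, rfl⟩

theorem step_iff {q q' : Quad A} : Step B q q' ↔ q' = q.next B := by
  refine ⟨?_, fun h => h ▸ q.step_next B⟩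
  rintro ⟨hx, γ, h, ht⟩
  obtain ⟨t', x', hm⟩ := q'
  obtain ⟨t, x, hm0⟩ := q
  simp only at hx ht
  subst hx ht
  obtain ⟨-, rfl⟩ := FinPath.mem_of_snoc_mem h hm
  rfl

theorem mk_next (q : Quad A) : (q.next B).mk' B = q.mk' B := (Quot.sound (q.step_next B)).symm

theorem mk_iterate (n : ℕ) (q : Quad A) : (((next B)^[n] q).mk' B) = q.mk' B := by
  induction n with
  | zero => rfl
  | succ n ih => rw [Function.iterate_succ_apply', mk_next, ih]

theorem mk_eq_iff {q q' : Quad A} :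
    q.mk' B = q'.mk' B ↔ ∃ n n', (next B)^[n] q = (next B)^[n'] q' := by
  constructor
  · intro h
    have h1 := Quot.eqvGen_exact h
    induction h1 with
    | rel a b hab => exact ⟨1, 0, ((step_iff B).1 hab).symm⟩
    | refl a => exact ⟨0, 0, rfl⟩
    | symm a b _ ih =>
      obtain ⟨n, n', h⟩ := ih (Quot.eqvGen_sound ‹_›)
      exact ⟨n', n, h.symm⟩
    | trans a b c hab hbc ih ih' =>
      obtain ⟨n, n', h⟩ := ih (Quot.eqvGen_sound hab)
      obtain ⟨k, k', h'⟩ := ih' (Quot.eqvGen_sound hbc)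
      refine ⟨k + n, n' + k', ?_⟩
      rw [Function.iterate_add_apply, h, ← Function.iterate_add_apply, add_comm k n',
        Function.iterate_add_apply, h', ← Function.iterate_add_apply]
  · rintro ⟨n, n', h⟩
    rw [← mk_iterate B n q, h, mk_iterate]

@[simp] theorem next_x (q : Quad A) : (q.next B).x = q.x := rfl

@[simp] theorem iterate_x (n : ℕ) (q : Quad A) : ((next B)^[n] q).x = q.x := by
  induction n with
  | zero => rfl
  | succ n ih => rw [Function.iterate_succ_apply', next_x, ih]

@[simp] theorem iterate_β_length (n : ℕ) (q : Quad A) :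
    ((next B)^[n] q).t.β.length = q.t.β.length + n := by
  induction n with
  | zero => rfl
  | succ n ih =>
    rw [Function.iterate_succ_apply', next_β_length, ih, add_assoc]

@[simp] theorem iterate_α_length (n : ℕ) (q : Quad A) :
    ((next B)^[n] q).t.α.length = q.t.α.length + n := by
  induction n with
  | zero => rfl
  | succ n ih =>
    rw [Function.iterate_succ_apply', next_α_length, ih, add_assoc]

theorem rng_next (q : Quad A) : (q.next B).rng B = q.rng B := by
  have h1 : (q.rng B) ∈ (q.next B).t.α.Z := by
    have h := FinPath.snoc_mem (q.rng_mem B)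
    simp only [rng_apply] at h
    exact h
  rw [← FinPath.concat_drop_of_mem h1]
  refine Subtype.ext (congrArg (prepend _) (congrArg Subtype.val ?_))
  have h4 : ∀ (k : ℕ) (x : InfPath A), x.drop (k + 1) = (x.drop k).drop 1 := fun k x =>
    Subtype.ext (funext fun i => congrArg x.1 (by ring))
  rw [next_α_length, next_β_length, h4 q.t.β.length, h4 q.t.α.length, drop_rng, ← InfPath.act_drop_one]
  rfl

@[simp] theorem rng_iterate (n : ℕ) (q : Quad A) : ((next B)^[n] q).rng B = q.rng B := by
  induction n with
  | zero => rfl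
  | succ n ih => rw [Function.iterate_succ_apply', rng_next, ih]

theorem ext' {q q' : Quad A} (hx : q.x = q'.x) (hr : q.rng B = q'.rng B)
    (hα : q.t.α.length = q'.t.α.length) (hβ : q.t.β.length = q'.t.β.length)
    (hm : q.t.m = q'.t.m) : q = q' :=
  Quad.ext (Triple.ext
    (FinPath.eq_of_mem (q.rng_mem B) (hr ▸ q'.rng_mem B) hα) hm
    (FinPath.eq_of_mem q.mem (hx ▸ q'.mem) hβ)) hx

/-- The quadruple `(β, -m, α; α κ_m(y))` for `q = (α, m, β; β y)`. -/
def inv (q : Quad A) : Quad A :=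
  ⟨⟨q.t.β, -q.t.m, q.t.α, q.t.tgt_eq.symm⟩, q.rng B, q.rng_mem B⟩

theorem rng_inv (q : Quad A) : (q.inv B).rng B = q.x := by
  rw [← FinPath.concat_drop_of_mem q.mem]
  refine Subtype.ext (congrArg (prepend _) (congrArg Subtype.val ?_))
  change ((q.rng B).drop q.t.α.length).act B (-q.t.m) = _
  rw [drop_rng, ← InfPath.act_add, neg_add_cancel, InfPath.act_zero]

theorem next_inv (q : Quad A) : (q.inv B).next B = (q.next B).inv B := by
  refine ext' B ?_ ?_ ?_ ?_ ?_
  · exact (rng_next B q).symm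
  · rw [rng_next, rng_inv, rng_inv, next_x]
  · exact (next_α_length B _).trans (next_β_length B q).symm
  · exact (next_β_length B _).trans (next_α_length B q).symm
  · change ((q.rng B).1 q.t.α.length).cocycle B (-q.t.m) = -((q.x.1 q.t.β.length).cocycle B q.t.m)
    have h := Edge.cocycle_add B (-q.t.m) q.t.m (q.x.1 q.t.β.length)
    rw [neg_add_cancel, Edge.cocycle_zero] at h
    rw [rng_apply]
    linarith

theorem iterate_inv (n : ℕ) (q : Quad A) : (next B)^[n] (q.inv B) = ((next B)^[n] q).inv B := by
  induction n with
  | zero => rfl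
  | succ n ih => rw [Function.iterate_succ_apply', ih, next_inv, Function.iterate_succ_apply']

/-- The quadruple `(α, m' + m, γ; x)` for `q' = (α, m', β; x')` and `q = (β, m, γ; x)`. -/
def comp (q' q : Quad A) (h : q'.t.β = q.t.α) : Quad A :=
  ⟨⟨q'.t.α, q'.t.m + q.t.m, q.t.β, q'.t.tgt_eq.trans (h ▸ q.t.tgt_eq)⟩, q.x, q.mem⟩

theorem rng_comp (q' q : Quad A) (h : q'.t.β = q.t.α) (hx : q'.x = q.rng B) :
    (comp q' q h).rng B = q'.rng B := by
  refine Subtype.ext (congrArg (prepend _) (congrArg Subtype.val ?_))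
  change (q.x.drop q.t.β.length).act B (q'.t.m + q.t.m) = _
  rw [InfPath.act_add, ← drop_rng, ← hx, h]

theorem next_β_eq {q' q : Quad A} (h : q'.t.β = q.t.α) (hx : q'.x = q.rng B) :
    (q'.next B).t.β = (q.next B).t.α := by
  refine FinPath.eq_of_mem (q'.next B).mem ?_ ?_
  · rw [next_x, hx, ← rng_next]
    exact rng_mem B _
  · rw [next_β_length, next_α_length, h]

theorem next_comp (q' q : Quad A) (h : q'.t.β = q.t.α) (hx : q'.x = q.rng B) :
    (comp q' q h).next B = comp (q'.next B) (q.next B) (next_β_eq B h hx) := by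
  refine ext' B rfl ?_ ?_ ?_ ?_
  · rw [rng_next, rng_comp B _ _ _ hx, rng_comp, rng_next]
    rw [next_x, rng_next, hx]
  · exact (next_α_length B _).trans (next_α_length B q').symm
  · rfl
  · change (q.x.1 q.t.β.length).cocycle B (q'.t.m + q.t.m) =
      (q'.x.1 q'.t.β.length).cocycle B q'.t.m + (q.x.1 q.t.β.length).cocycle B q.t.m
    rw [Edge.cocycle_add, hx, h, rng_apply]

theorem iterate_comp (n : ℕ) (q' q : Quad A) (h : q'.t.β = q.t.α) (hx : q'.x = q.rng B) :
    ∃ h', (next B)^[n] (comp q' q h) = comp ((next B)^[n] q') ((next B)^[n] q) h' := by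
  induction n with
  | zero => exact ⟨h, rfl⟩
  | succ n ih =>
    obtain ⟨h', e⟩ := ih
    have hx' : ((next B)^[n] q').x = ((next B)^[n] q).rng B := by simp [hx]
    simp only [Function.iterate_succ_apply']
    exact ⟨next_β_eq B h' hx', by rw [e, next_comp B _ _ h' hx']⟩

/-- The quadruple `(v, 0, v; x)`, where `v = s(x)`. -/
def unit (x : InfPath A) : Quad A :=
  ⟨⟨FinPath.vertex A x.src, 0, FinPath.vertex A x.src, rfl⟩, x, ⟨x, rfl, rfl⟩⟩

/-- The quadruple `(β, 0, β; x)`. -/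
def diag (β : FinPath A) (x : InfPath A) (hx : x ∈ β.Z) : Quad A := ⟨⟨β, 0, β, rfl⟩, x, hx⟩

theorem rng_diag (β : FinPath A) (x : InfPath A) (hx : x ∈ β.Z) : (diag β x hx).rng B = x := by
  refine Eq.trans ?_ (FinPath.concat_drop_of_mem hx)
  refine Subtype.ext (congrArg (prepend _) (congrArg Subtype.val ?_))
  exact InfPath.act_zero B _

theorem rng_unit (x : InfPath A) : (unit x).rng B = x := rng_diag B _ x _

theorem next_diag (β : FinPath A) (x : InfPath A) (hx : x ∈ β.Z) :
    (diag β x hx).next B = diag _ x (FinPath.snoc_mem hx) := by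
  refine ext' B rfl ?_ ?_ rfl ?_
  · rw [rng_next, rng_diag, rng_diag]
  · exact (next_α_length B _).trans (FinPath.length_snoc _ _ (FinPath.src_apply_of_mem hx)).symm
  · exact Edge.cocycle_zero B _

theorem iterate_unit (n : ℕ) (x : InfPath A) :
    ∃ β hx, β.length = n ∧ (next B)^[n] (unit x) = diag β x hx := by
  induction n with
  | zero => exact ⟨_, _, rfl, rfl⟩
  | succ n ih =>
    obtain ⟨β, hx, hl, e⟩ := ih
    exact ⟨_, FinPath.snoc_mem hx, by rw [FinPath.length_snoc, hl],
      by rw [Function.iterate_succ_apply', e, next_diag]⟩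

theorem mk_diag (β : FinPath A) (x : InfPath A) (hx : x ∈ β.Z) :
    (diag β x hx).mk' B = (unit x).mk' B := by
  obtain ⟨β', hx', hl, e⟩ := iterate_unit B β.length x
  obtain rfl := FinPath.eq_of_mem hx hx' hl.symm
  rw [← mk_iterate B β.length (unit x), e]

end Quad

namespace Arrow

variable {B}

/-- `s([α, m, β; x]) = x`. -/
def s : Arrow A B → InfPath A :=
  Quot.lift (fun q => q.x) fun _ _ h => h.1.symm

/-- `r([α, m, β; β y]) = α κ_m(y)`. -/
def r : Arrow A B → InfPath A :=
  Quot.lift (fun q => q.rng B) fun q q' h => by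
    rw [Quad.step_iff] at h; simp only [h, Quad.rng_next]

/-- The unit `[v, 0, v; x]`. -/
def one (x : InfPath A) : Arrow A B := (Quad.unit x).mk' B

/-- `[α, m, β; β y]⁻¹ = [β, -m, α; α κ_m(y)]`. -/
def inv : Arrow A B → Arrow A B :=
  Quot.lift (fun q => (q.inv B).mk' B) fun q q' h => by
    rw [Quad.step_iff] at h; simp only [h, ← Quad.next_inv, Quad.mk_next]

/-- The homomorphism `ρ([α, m, β; x]) = |α| - |β|`. -/
def ρ : Arrow A B → ℤ :=
  Quot.lift (fun q => (q.t.α.length : ℤ) - q.t.β.length) fun q q' h => by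
    rw [Quad.step_iff] at h
    have h1 := Quad.iterate_α_length B 1 q
    have h2 := Quad.iterate_β_length B 1 q
    simp only [Function.iterate_one] at h1 h2
    simp only [h, h1, h2]
    push_cast
    ring

/-- `IsMul g h k` says that, for suitable representatives, `g = [α, m', β; β κ_m(y)]`,
`h = [β, m, γ; γ y]` and `k = [α, m' + m, γ; γ y]`. -/
def IsMul (g h k : Arrow A B) : Prop :=
  ∃ (q' q : Quad A) (hm : q'.t.β = q.t.α), q'.x = q.rng B ∧
    g = q'.mk' B ∧ h = q.mk' B ∧ k = (q'.comp q hm).mk' B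

theorem exists_aligned (g h : Arrow A B) (c : g.s = h.r) :
    ∃ q' q : Quad A, q'.t.β = q.t.α ∧ q'.x = q.rng B ∧ g = q'.mk' B ∧ h = q.mk' B := by
  obtain ⟨q', rfl⟩ := Quot.exists_rep g
  obtain ⟨q, rfl⟩ := Quot.exists_rep h
  have hx : q'.x = q.rng B := c
  refine ⟨(Quad.next B)^[q.t.α.length] q', (Quad.next B)^[q'.t.β.length] q, ?_, by simp [hx],
    (Quad.mk_iterate B _ _).symm, (Quad.mk_iterate B _ _).symm⟩
  refine FinPath.eq_of_mem (Quad.mem _) ?_ (by simp [add_comm])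
  have := Quad.rng_mem B ((Quad.next B)^[q'.t.β.length] q)
  simpa [hx] using this

theorem exists_isMul (g h : Arrow A B) (c : g.s = h.r) : ∃ k, IsMul g h k := by
  obtain ⟨q', q, hm, hx, hg, hh⟩ := exists_aligned g h c
  exact ⟨_, q', q, hm, hx, hg, hh, rfl⟩

theorem IsMul.unique {g h k k' : Arrow A B} (h1 : IsMul g h k) (h2 : IsMul g h k') : k = k' := by
  obtain ⟨p', p, hp, hpx, rfl, rfl, rfl⟩ := h1
  obtain ⟨q', q, hq, hqx, hg, hh, rfl⟩ := h2
  obtain ⟨a, b, hab⟩ := (Quad.mk_eq_iff B).1 hg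
  obtain ⟨c, d, hcd⟩ := (Quad.mk_eq_iff B).1 hh
  have l1 := congrArg (fun q => q.t.β.length) hab
  have l2 := congrArg (fun q => q.t.α.length) hcd
  simp only [Quad.iterate_β_length, Quad.iterate_α_length] at l1 l2
  have e1 : p'.t.β.length = p.t.α.length := by rw [hp]
  have e2 : q'.t.β.length = q.t.α.length := by rw [hq]
  refine (Quad.mk_eq_iff B).2 ⟨a + c, b + c, ?_⟩
  obtain ⟨h3, e3⟩ := Quad.iterate_comp B (a + c) p' p hp hpx
  obtain ⟨h4, e4⟩ := Quad.iterate_comp B (b + c) q' q hq hqx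
  have e5 : (Quad.next B)^[a + c] p' = (Quad.next B)^[b + c] q' := by
    rw [add_comm a, add_comm b, Function.iterate_add_apply, hab, ← Function.iterate_add_apply]
  have e6 : (Quad.next B)^[a + c] p = (Quad.next B)^[b + c] q := by
    rw [Function.iterate_add_apply, hcd, ← Function.iterate_add_apply]
    congr 1
    omega
  rw [e3, e4]
  simp only [e5, e6]

/-- The product, determined by
`[α, m', β; β κ_m(y)] · [β, m, γ; γ y] = [α, m' + m, γ; γ y]`. -/
noncomputable def mul (g h : Arrow A B) (c : g.s = h.r) : Arrow A B := (exists_isMul g h c).choose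

theorem mul_mk (q' q : Quad A) (hm : q'.t.β = q.t.α) (hx : q'.x = q.rng B) :
    mul (q'.mk' B) (q.mk' B) hx = (q'.comp q hm).mk' B :=
  (exists_isMul (q'.mk' B) (q.mk' B) hx).choose_spec.unique ⟨q', q, hm, hx, rfl, rfl, rfl⟩

/-- The set `Z(α, m, β; Z(β)) = {[α, m, β; x] : x ∈ Z(β)}`. -/
def basicSet (B : Matrix V V ℤ) (t : Triple A) : Set (Arrow A B) :=
  {g | ∃ (x : InfPath A) (hx : x ∈ t.β.Z), g = (Quad.mk t x hx).mk' B}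

/-- The topology with basis the sets `Z(α, m, β; Z(β))`. -/
instance : TopologicalSpace (Arrow A B) :=
  TopologicalSpace.generateFrom {S | ∃ t : Triple A, S = basicSet B t}

theorem isOpen_basicSet (t : Triple A) : IsOpen (basicSet B t) :=
  TopologicalSpace.isOpen_generateFrom_of_mem ⟨t, rfl⟩

theorem mk_mem_basicSet (q : Quad A) : q.mk' B ∈ basicSet B q.t := ⟨q.x, q.mem, rfl⟩

theorem basicSet_next (q : Quad A) : basicSet B (q.next B).t ⊆ basicSet B q.t := by
  rintro _ ⟨x, hx, rfl⟩
  obtain ⟨h1, h2⟩ := FinPath.mem_of_snoc_mem (FinPath.src_apply_of_mem q.mem) hx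
  exact ⟨x, h1, (Quot.sound ⟨rfl, _, _, rfl⟩).symm⟩

theorem basicSet_anti (q : Quad A) {n k : ℕ} (h : n ≤ k) :
    basicSet B ((Quad.next B)^[k] q).t ⊆ basicSet B ((Quad.next B)^[n] q).t := by
  induction k, h using Nat.le_induction with
  | base => exact subset_rfl
  | succ k _ ih =>
    rw [Function.iterate_succ_apply']
    exact (basicSet_next _).trans ih

theorem exists_basicSet {S : Set (Arrow A B)} (hS : IsOpen S) (q : Quad A) (hq : q.mk' B ∈ S) :
    ∃ n, basicSet B ((Quad.next B)^[n] q).t ⊆ S := by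
  induction hS with
  | basic S h =>
    obtain ⟨t, rfl⟩ := h
    obtain ⟨x, hx, e⟩ := hq
    obtain ⟨n, n', h⟩ := (Quad.mk_eq_iff B).1 e
    refine ⟨n, ?_⟩
    rw [h]
    exact basicSet_anti ⟨t, x, hx⟩ (Nat.zero_le n')
  | univ => exact ⟨0, Set.subset_univ _⟩
  | inter S T _ _ ihS ihT =>
    obtain ⟨n, hn⟩ := ihS hq.1
    obtain ⟨k, hk⟩ := ihT hq.2
    exact ⟨max n k, Set.subset_inter ((basicSet_anti q (le_max_left n k)).trans hn)
      ((basicSet_anti q (le_max_right n k)).trans hk)⟩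
  | sUnion 𝒮 _ ih =>
    obtain ⟨S, hS, hqS⟩ := hq
    obtain ⟨n, hn⟩ := ih S hS hqS
    exact ⟨n, hn.trans (Set.subset_sUnion_of_mem hS)⟩

theorem continuous_s : Continuous (s : Arrow A B → InfPath A) := by
  refine continuous_def.2 fun U hU => isOpen_iff_forall_mem_open.2 fun g hg => ?_
  obtain ⟨q, rfl⟩ := Quot.exists_rep g
  obtain ⟨n, hn⟩ := InfPath.exists_cylinder hU (x := q.x) hg
  refine ⟨basicSet B ((Quad.next B)^[n] q).t, ?_, isOpen_basicSet _, ?_⟩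
  · rintro _ ⟨x, hx, rfl⟩
    refine hn x fun i hi => ?_
    have h1 := ((FinPath.mem_Z_iff (((Quad.next B)^[n] q).mem)).1 hx).2 i
      (by rw [Quad.iterate_β_length]; omega)
    rwa [Quad.iterate_x] at h1
  · have := mk_mem_basicSet (B := B) ((Quad.next B)^[n] q)
    rwa [Quad.mk_iterate] at this

theorem image_s_basicSet (t : Triple A) : s '' (basicSet B t) = t.β.Z := by
  ext x
  constructor
  · rintro ⟨_, ⟨x, hx, rfl⟩, rfl⟩
    exact hx
  · intro hx
    exact ⟨_, ⟨x, hx, rfl⟩, rfl⟩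

theorem isOpenMap_s : IsOpenMap (s : Arrow A B → InfPath A) := by
  intro S hS
  refine isOpen_iff_forall_mem_open.2 ?_
  rintro _ ⟨g, hg, rfl⟩
  obtain ⟨q, rfl⟩ := Quot.exists_rep g
  obtain ⟨n, hn⟩ := exists_basicSet hS q hg
  refine ⟨_, Set.image_mono hn, ?_, ?_⟩
  · rw [image_s_basicSet]
    exact FinPath.isOpen_Z _
  · rw [image_s_basicSet]
    have := ((Quad.next B)^[n] q).mem
    rwa [Quad.iterate_x] at this

theorem isLocalHomeomorph_s : IsLocalHomeomorph (s : Arrow A B → InfPath A) := by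
  rw [isLocalHomeomorph_iff_isOpenEmbedding_restrict]
  intro g
  obtain ⟨q, rfl⟩ := Quot.exists_rep g
  refine ⟨basicSet B q.t, (isOpen_basicSet _).mem_nhds (mk_mem_basicSet q), ?_⟩
  refine Topology.IsOpenEmbedding.of_continuous_injective_isOpenMap
    (continuous_s.comp continuous_subtype_val) ?_ (isOpenMap_s.domRestrict (isOpen_basicSet _))
  rintro ⟨_, x, hx, rfl⟩ ⟨_, x', hx', rfl⟩ h
  obtain rfl : x = x' := h
  rfl

theorem continuous_one : Continuous (one : InfPath A → Arrow A B) := by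
  refine continuous_def.2 fun S hS => isOpen_iff_forall_mem_open.2 fun x hx => ?_
  obtain ⟨n, hn⟩ := exists_basicSet hS (Quad.unit x) hx
  obtain ⟨β, hβ, -, e⟩ := Quad.iterate_unit B n x
  refine ⟨β.Z, fun x' hx' => hn ?_, FinPath.isOpen_Z _, hβ⟩
  rw [e]
  exact ⟨x', hx', (Quad.mk_diag B β x' hx').symm⟩

theorem continuous_inv : Continuous (inv : Arrow A B → Arrow A B) := by
  refine continuous_def.2 fun S hS => isOpen_iff_forall_mem_open.2 fun g hg => ?_
  obtain ⟨q, rfl⟩ := Quot.exists_rep g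
  obtain ⟨n, hn⟩ := exists_basicSet hS (q.inv B) hg
  refine ⟨basicSet B ((Quad.next B)^[n] q).t, ?_, isOpen_basicSet _, ?_⟩
  · rintro _ ⟨x, hx, rfl⟩
    refine hn ?_
    rw [Quad.iterate_inv]
    exact ⟨_, _, rfl⟩
  · have := mk_mem_basicSet (B := B) ((Quad.next B)^[n] q)
    rwa [Quad.mk_iterate] at this

theorem continuous_mul : Continuous fun p : {p : Arrow A B × Arrow A B // s p.1 = r p.2} =>
    mul p.1.1 p.1.2 p.2 := by
  refine continuous_def.2 fun S hS => isOpen_iff_forall_mem_open.2 ?_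
  rintro ⟨⟨g, h⟩, c⟩ hp
  obtain ⟨q', q, hm, hx, rfl, rfl⟩ := exists_aligned g h c
  change mul _ _ _ ∈ S at hp
  rw [mul_mk q' q hm hx] at hp
  obtain ⟨n, hn⟩ := exists_basicSet hS _ hp
  obtain ⟨hm', e⟩ := Quad.iterate_comp B n q' q hm hx
  rw [e] at hn
  refine ⟨{p | p.1.1 ∈ basicSet B ((Quad.next B)^[n] q').t ∧
    p.1.2 ∈ basicSet B ((Quad.next B)^[n] q).t}, ?_, ?_, ?_, ?_⟩
  · rintro ⟨⟨_, _⟩, c⟩ ⟨⟨x', hx', rfl⟩, ⟨x, hx, rfl⟩⟩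
    refine hn ?_
    change mul _ _ _ ∈ _
    rw [mul_mk ⟨_, x', hx'⟩ ⟨_, x, hx⟩ hm' c]
    exact ⟨x, hx, rfl⟩
  · exact ((isOpen_basicSet _).preimage (by fun_prop)).inter
      ((isOpen_basicSet _).preimage (by fun_prop))
  · have := mk_mem_basicSet (B := B) ((Quad.next B)^[n] q')
    rwa [Quad.mk_iterate] at this
  · have := mk_mem_basicSet (B := B) ((Quad.next B)^[n] q)
    rwa [Quad.mk_iterate] at this

theorem continuous_ρ : Continuous (ρ : Arrow A B → ℤ) := by
  refine continuous_def.2 fun S _ => isOpen_iff_forall_mem_open.2 fun g hg => ?_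
  obtain ⟨q, rfl⟩ := Quot.exists_rep g
  refine ⟨basicSet B q.t, ?_, isOpen_basicSet _, mk_mem_basicSet q⟩
  rintro _ ⟨x, hx, rfl⟩
  exact hg

theorem ρ_mul (g h : Arrow A B) (c : g.s = h.r) : ρ (mul g h c) = ρ g + ρ h := by
  obtain ⟨q', q, hm, hx, rfl, rfl⟩ := exists_aligned g h c
  rw [mul_mk q' q hm hx]
  change (q'.t.α.length : ℤ) - q.t.β.length =
    ((q'.t.α.length : ℤ) - q'.t.β.length) + ((q.t.α.length : ℤ) - q.t.β.length)
  rw [hm]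
  ring

theorem s_mul (g h : Arrow A B) (c : g.s = h.r) : s (mul g h c) = s h := by
  obtain ⟨q', q, hm, hx, rfl, rfl⟩ := exists_aligned g h c
  rw [mul_mk q' q hm hx]
  rfl

theorem r_mul (g h : Arrow A B) (c : g.s = h.r) : r (mul g h c) = r g := by
  obtain ⟨q', q, hm, hx, rfl, rfl⟩ := exists_aligned g h c
  rw [mul_mk q' q hm hx]
  exact Quad.rng_comp B q' q hm hx

theorem s_one (x : InfPath A) : s (one x : Arrow A B) = x := rfl

theorem r_one (x : InfPath A) : r (one x : Arrow A B) = x := Quad.rng_unit B x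

theorem s_inv (g : Arrow A B) : s (inv g) = r g := by
  obtain ⟨q, rfl⟩ := Quot.exists_rep g
  rfl

theorem r_inv (g : Arrow A B) : r (inv g) = s g := by
  obtain ⟨q, rfl⟩ := Quot.exists_rep g
  exact Quad.rng_inv B q

theorem mul_congr {g g' h h' : Arrow A B} (hg : g = g') (hh : h = h') (c : g.s = h.r)
    (c' : g'.s = h'.r) : mul g h c = mul g' h' c' := by
  subst hg hh
  rfl

theorem one_mul (g : Arrow A B) : mul (one (r g)) g (s_one _) = g := by
  obtain ⟨q, rfl⟩ := Quot.exists_rep g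
  refine (mul_congr (Quad.mk_diag B q.t.α (q.rng B) (q.rng_mem B)).symm rfl _ rfl).trans ?_
  refine (mul_mk (Quad.diag q.t.α (q.rng B) (q.rng_mem B)) q rfl rfl).trans ?_
  refine congrArg (Quad.mk' B) (Quad.ext (Triple.ext rfl ?_ rfl) rfl)
  exact zero_add _

theorem mul_one (g : Arrow A B) : mul g (one (s g)) (r_one _).symm = g := by
  obtain ⟨q, rfl⟩ := Quot.exists_rep g
  have hx : q.x = (Quad.diag q.t.β q.x q.mem).rng B := (Quad.rng_diag B _ _ _).symm
  refine (mul_congr (g' := q.mk' B) rfl (Quad.mk_diag B q.t.β q.x q.mem).symm _ hx).trans ?_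
  refine (mul_mk q (Quad.diag q.t.β q.x q.mem) rfl hx).trans ?_
  refine congrArg (Quad.mk' B) (Quad.ext (Triple.ext rfl ?_ rfl) rfl)
  exact add_zero _

theorem inv_mul (g : Arrow A B) : mul (inv g) g (s_inv g) = one (s g) := by
  obtain ⟨q, rfl⟩ := Quot.exists_rep g
  refine (mul_mk (q.inv B) q rfl rfl).trans ?_
  refine Eq.trans ?_ (Quad.mk_diag B q.t.β q.x q.mem)
  refine congrArg (Quad.mk' B) (Quad.ext (Triple.ext rfl ?_ rfl) rfl)
  exact neg_add_cancel _

theorem mul_inv (g : Arrow A B) : mul g (inv g) (r_inv g).symm = one (r g) := by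
  obtain ⟨q, rfl⟩ := Quot.exists_rep g
  refine (mul_mk q (q.inv B) rfl (q.rng_inv B).symm).trans ?_
  refine Eq.trans ?_ (Quad.mk_diag B q.t.α (q.rng B) (q.rng_mem B))
  refine congrArg (Quad.mk' B) (Quad.ext (Triple.ext rfl ?_ rfl) rfl)
  exact add_neg_cancel _

theorem mul_assoc (g h k : Arrow A B) (c : g.s = h.r) (d : h.s = k.r) :
    mul (mul g h c) k ((s_mul g h c).trans d) = mul g (mul h k d) (c.trans (r_mul h k d).symm) := by
  obtain ⟨p, q, hm, hx, rfl, rfl⟩ := exists_aligned g h c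
  obtain ⟨w, rfl⟩ := Quot.exists_rep k
  have hd : q.x = w.rng B := d
  -- extend all three representatives so that the middle paths match
  obtain ⟨hpq, -⟩ := Quad.iterate_comp B w.t.α.length p q hm hx
  have hqw : ((Quad.next B)^[w.t.α.length] q).t.β = ((Quad.next B)^[q.t.β.length] w).t.α := by
    refine FinPath.eq_of_mem (Quad.mem _) ?_ (by simp [add_comm])
    have := Quad.rng_mem B ((Quad.next B)^[q.t.β.length] w)
    simpa [hd] using this
  generalize hp' : (Quad.next B)^[w.t.α.length] p = p' at *
  generalize hq' : (Quad.next B)^[w.t.α.length] q = q' at *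
  generalize hw' : (Quad.next B)^[q.t.β.length] w = w' at *
  have ep : p.mk' B = p'.mk' B := by rw [← hp', Quad.mk_iterate]
  have eq : q.mk' B = q'.mk' B := by rw [← hq', Quad.mk_iterate]
  have ew : Quot.mk (Step B) w = w'.mk' B := by rw [← hw', Quad.mk_iterate]; rfl
  have hx' : p'.x = q'.rng B := by rw [← hp', ← hq']; simpa using hx
  have hd' : q'.x = w'.rng B := by rw [← hq', ← hw']; simpa using hd
  have e1 : mul (p.mk' B) (q.mk' B) c = (p'.comp q' hpq).mk' B :=
    (mul_congr ep eq c hx').trans (mul_mk p' q' hpq hx')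
  have e2 : mul (q.mk' B) (Quot.mk (Step B) w) d = (q'.comp w' hqw).mk' B :=
    (mul_congr eq ew d hd').trans (mul_mk q' w' hqw hd')
  have hx2 : p'.x = (q'.comp w' hqw).rng B := by rw [Quad.rng_comp B _ _ _ hd', hx']
  refine (mul_congr e1 ew _ hd').trans ?_
  refine (mul_mk (p'.comp q' hpq) w' hqw hd').trans ?_
  refine Eq.trans ?_ (mul_congr ep e2 _ hx2).symm
  refine Eq.trans ?_ (mul_mk p' (q'.comp w' hqw) hpq hx2).symm
  refine congrArg (Quad.mk' B) (Quad.ext (Triple.ext rfl ?_ rfl) rfl)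
  exact add_assoc _ _ _

end Arrow

/-- The Katsura–Exel–Pardo groupoid `𝒢_{A,B}`. -/
noncomputable def groupoid (A B : Matrix V V ℤ) : EtaleGroupoid (Arrow A B) (InfPath A) where
  s := Arrow.s
  r := Arrow.r
  one := Arrow.one
  mul := Arrow.mul
  inv := Arrow.inv
  s_one := Arrow.s_one
  r_one := Arrow.r_one
  s_mul := Arrow.s_mul
  r_mul := Arrow.r_mul
  s_inv := Arrow.s_inv
  r_inv := Arrow.r_inv
  one_mul := Arrow.one_mul
  mul_one := Arrow.mul_one
  mul_assoc := Arrow.mul_assoc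
  inv_mul := Arrow.inv_mul
  mul_inv := Arrow.mul_inv
  continuous_one := Arrow.continuous_one
  continuous_inv := Arrow.continuous_inv
  continuous_mul := Arrow.continuous_mul
  isLocalHomeomorph_s := Arrow.isLocalHomeomorph_s

/-- The kernel `ℋ_{A,B}` of the length cocycle `ρ`. -/
noncomputable def kerGroupoid (A B : Matrix V V ℤ) :
    EtaleGroupoid {g : Arrow A B // Arrow.ρ g = 0} (InfPath A) :=
  (groupoid A B).ker Arrow.ρ Arrow.ρ_mul Arrow.continuous_ρ

/-- The subset `Z(α, m, α; Z(α))` of `ℋ_{A,B}`. -/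
def diagSet (A B : Matrix V V ℤ) (α : FinPath A) (m : ℤ) : Set {g : Arrow A B // Arrow.ρ g = 0} :=
  {g | g.1 ∈ Arrow.basicSet B ⟨α, m, α, rfl⟩}

/-! ### The inductive limit `ℤ_B` -/

/-- The endomorphism `1_v ↦ ∑_w B_{v,w} 1_w` of the free abelian group on the vertices. -/
noncomputable def connecting (hB : RowFinite B) : Module.End ℤ (V →₀ ℤ) :=
  Finsupp.linearCombination ℤ fun v => Finsupp.ofSupportFinite (B v) (hB v)

/-- `ℤ_B`, the inductive limit of the free abelian groups on the vertices, indexed by `n ∈ ℕ`,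
with all connecting maps from stage `n` to stage `n + 1` equal to `connecting B`. -/
abbrev IndLimit (hB : RowFinite B) : Type _ :=
  Module.DirectLimit (R := ℤ) (ι := ℕ) (fun _ => V →₀ ℤ)
    (fun i j _ => connecting B hB ^ (j - i))

/-- The canonical map `φ^B_{n,∞}` from stage `n` to the inductive limit. -/
noncomputable def toLimit (hB : RowFinite B) (n : ℕ) : (V →₀ ℤ) →ₗ[ℤ] IndLimit B hB :=
  Module.DirectLimit.of ℤ ℕ (fun _ => V →₀ ℤ) (fun i j _ => connecting B hB ^ (j - i)) n

end Katsura

/-! Fix a level `n` and consider the triples `(α, m, β)` with `|α| = |β| = n` and `r(α) = r(β)`,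
composed by adding the integers. They form a discrete groupoid: two paths lie in one component
exactly when they have the same range, and every isotropy group is `ℤ`. Its first homology is
therefore free on the vertices that are ranges of paths of length `n`, generated by the triples `(α,
1, α)`. The theorem says that `H₁` of the kernel groupoid is the limit of these groups over `n`.

The link with functions is that the sets `Z(α, m, β; Z(β))` of one level are compact open, nonempty
and, by pseudo-freeness, pairwise disjoint, while every compactly supported function is constant on
the members of some level (`exists_realize`). So a function is a finitely supported family of
coefficients, unique at its level. The same holds for composable pairs, and `δ₂` of the indicator of
a pair stays within its level.

Passing to the next level splits `(α, m, β)` into the triples `(α κ_m(γ), φ(m,γ), β γ)`. Summing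
`φ(m,γ)` over the edges from `v` to `w` gives `m B_{v,w}`, by Hermite's identity (`sum_cocycle`).
Hence `(α, m, β) ↦ m 1_{r(β)}` turns refinement into the connecting map and defines a homomorphism
`limitHom` on all of `C_c`. It kills boundaries because `m` is additive under composition.

Injectivity: modulo boundaries, `(α, m, β)` equals `(α, 0, τ) - (β, 0, τ) + m (τ, 1, τ)` for a base
path `τ` with the same range (`indClass_eq`). So the class of a chain depends only on its boundary
in paths and its image in vertices. For a cycle the first vanishes, and if its value in the limit is
zero then the second vanishes at a later level.

Surjectivity and uniqueness: the elements `φ^B_{n,∞}(1_{r(α)})` generate the limit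
(`closure_toLimit_eq_top`). A vertex at stage `n` need not be the range of a path of length `n`, but
after finitely many further stages only such ranges occur. -/

/-! ### Indicator functions of compact open sets -/

/-- The indicator function of a compact open and closed set. -/
noncomputable def indicatorCc {X : Type*} [TopologicalSpace X] (U : Set X) (hU : IsClopen U)
    (hc : IsCompact U) : C_c(X, ℤ) where
  toFun := U.indicator 1
  continuous_toFun := (continuous_const (y := (1 : ℤ))).indicator (by simp [hU.frontier_eq])
  hasCompactSupport' := by
    refine hc.of_isClosed_subset (isClosed_tsupport _) ?_
    exact closure_minimal Set.support_indicator_subset hU.isClosed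

/-- A fibre meets `U` in one point over `W` and in none elsewhere, so the sum has at most one
nonzero term. All of `s`, `r`, `d₀`, `d₁`, `d₂` are handled this way on members of the bases. -/
theorem pushforward_eq_indicator {X Y : Type*} [TopologicalSpace X] {π : X → Y}
    (hπ : IsLocallyInjective π) (f : C_c(X, ℤ)) {U : Set X} {W : Set Y}
    (hf : ⇑f = U.indicator 1) (hUW : Set.BijOn π U W) :
    pushforward π hπ f = W.indicator 1 := by
  classical
  ext y
  change ∑ᶠ x : {x : X // π x = y}, f x = _
  by_cases hy : y ∈ W
  · obtain ⟨x, hx, rfl⟩ := hUW.surjOn hy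
    rw [finsum_eq_single _ ⟨x, rfl⟩]
    · simp [hf, hx, hy]
    · rintro ⟨x', hx'⟩ hne
      have : x' ∉ U := fun h => hne (Subtype.ext (hUW.injOn h hx hx'))
      simp [hf, this]
  · rw [finsum_eq_zero_of_forall_eq_zero]
    · simp [hy]
    · rintro ⟨x, rfl⟩
      have : x ∉ U := fun h => hy (hUW.mapsTo h)
      simp [hf, this]

/-! ### Bases of open sets arranged in levels -/

/-- A basis of open sets arranged in levels: the members of one level are pairwise disjoint, and
each member of a level is covered by the members of any later level contained in it. -/
structure LevelBasis (X : Type*) [TopologicalSpace X] (ι : ℕ → Type*) where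
  U : ∀ n, ι n → Set X
  isOpen : ∀ n i, IsOpen (U n i)
  isCompact : ∀ n i, IsCompact (U n i)
  eq_of_mem : ∀ n i j x, x ∈ U n i → x ∈ U n j → i = j
  exists_subset : ∀ n k i x, n ≤ k → x ∈ U n i → ∃ j, x ∈ U k j ∧ U k j ⊆ U n i
  exists_mem : ∀ (W : Set X) x, IsOpen W → x ∈ W → ∃ n i, x ∈ U n i ∧ U n i ⊆ W

namespace LevelBasis

variable {X : Type*} [TopologicalSpace X] {ι : ℕ → Type*} (𝒰 : LevelBasis X ι)

/-- Closedness comes from disjointness within a level rather than from a separation axiom: at a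
level beyond both `n` and that of a neighbourhood of `x`, the member containing `x` lies inside `U n
i` as soon as it meets it. -/
theorem isClopen (n : ℕ) (i : ι n) : IsClopen (𝒰.U n i) := by
  refine ⟨⟨isOpen_iff_forall_mem_open.2 fun x hx => ?_⟩, 𝒰.isOpen n i⟩
  obtain ⟨k, j, hj, -⟩ := 𝒰.exists_mem Set.univ x isOpen_univ (Set.mem_univ x)
  obtain ⟨j', hj', -⟩ := 𝒰.exists_subset k (max n k) j x (le_max_right _ _) hj
  refine ⟨𝒰.U _ j', fun y hy hyi => hx ?_, 𝒰.isOpen _ _, hj'⟩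
  obtain ⟨i', hi', hsub⟩ := 𝒰.exists_subset n (max n k) i y (le_max_left _ _) hyi
  obtain rfl := 𝒰.eq_of_mem _ _ _ _ hy hi'
  exact hsub hj'

/-- The indicator function of a member of the basis. -/
noncomputable def ind (n : ℕ) (i : ι n) : C_c(X, ℤ) :=
  indicatorCc (𝒰.U n i) (𝒰.isClopen n i) (𝒰.isCompact n i)

theorem coe_ind (n : ℕ) (i : ι n) : ⇑(𝒰.ind n i) = (𝒰.U n i).indicator 1 := rfl

/-- The linear combinations of the indicator functions of the members of one level. -/
noncomputable def realize (n : ℕ) : (ι n →₀ ℤ) →ₗ[ℤ] C_c(X, ℤ) :=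
  Finsupp.linearCombination ℤ (𝒰.ind n)

@[simp] theorem realize_single (n : ℕ) (i : ι n) (c : ℤ) :
    𝒰.realize n (Finsupp.single i c) = c • 𝒰.ind n i := Finsupp.linearCombination_single _ _ _

theorem realize_apply_of_mem {n : ℕ} {i : ι n} {x : X} (hx : x ∈ 𝒰.U n i) (F : ι n →₀ ℤ) :
    𝒰.realize n F x = F i := by
  classical
  induction F using Finsupp.induction_linear with
  | zero => simp
  | add F G hF hG => rw [map_add, CompactlySupportedContinuousMap.coe_add, Pi.add_apply, hF, hG,
      Finsupp.add_apply]
  | single j c =>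
    rw [realize_single]
    have h : (c • 𝒰.ind n j) x = c * (𝒰.U n j).indicator 1 x := by
      simp [coe_ind]
    rw [h]
    by_cases hij : j = i
    · subst hij; simp [hx]
    · have : x ∉ 𝒰.U n j := fun h => hij (𝒰.eq_of_mem _ _ _ _ h hx)
      simp [this, hij]

theorem realize_apply_of_notMem {n : ℕ} {x : X} (hx : ∀ i, x ∉ 𝒰.U n i) (F : ι n →₀ ℤ) :
    𝒰.realize n F x = 0 := by
  classical
  induction F using Finsupp.induction_linear with
  | zero => simp
  | add F G hF hG => rw [map_add, CompactlySupportedContinuousMap.coe_add, Pi.add_apply, hF, hG,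
      add_zero]
  | single j c =>
    rw [realize_single]
    have h : (c • 𝒰.ind n j) x = c * (𝒰.U n j).indicator 1 x := by
      simp [coe_ind]
    simp [h, hx j]

theorem realize_injective (hne : ∀ n i, (𝒰.U n i).Nonempty) (n : ℕ) :
    Function.Injective (𝒰.realize n) := by
  intro F G h
  ext i
  obtain ⟨x, hx⟩ := hne n i
  rw [← 𝒰.realize_apply_of_mem hx, h, 𝒰.realize_apply_of_mem hx]

/-- Every compactly supported function is a linear combination of indicator functions of members
of a single level. -/
theorem exists_realize (f : C_c(X, ℤ)) : ∃ n F, 𝒰.realize n F = f := by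
  classical
  have hW : ∀ x, IsOpen (f ⁻¹' {f x}) := fun x =>
    (isOpen_discrete _).preimage f.continuous_toFun
  choose k i hi hsub using fun x => 𝒰.exists_mem (f ⁻¹' {f x}) x (hW x) rfl
  have hK : IsCompact (tsupport f) := f.hasCompactSupport
  obtain ⟨t, ht⟩ := hK.elim_finite_subcover (fun x => 𝒰.U (k x) (i x)) (fun x => 𝒰.isOpen _ _)
    (fun x _ => Set.mem_iUnion.2 ⟨x, hi x⟩)
  -- Finitely many members on which `f` is constant cover the support; `N` is a level beyond all of
  -- theirs.
  set N := t.sup k with hN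
  have hcov : ∀ x ∈ tsupport f, ∃ j, x ∈ 𝒰.U N j ∧ ∀ y ∈ 𝒰.U N j, f y = f x := by
    intro x hx
    obtain ⟨y, hy, hxy⟩ := Set.mem_iUnion₂.1 (ht hx)
    obtain ⟨j, hj, hjs⟩ := 𝒰.exists_subset _ N _ x (Finset.le_sup (f := k) hy) hxy
    refine ⟨j, hj, fun z hz => ?_⟩
    have h1 : f z = f y := hsub y (hjs hz)
    have h2 : f x = f y := hsub y hxy
    rw [h1, h2]
  -- If `f` is nonzero somewhere on a member of level `N`, then by disjointness that member is one
  -- supplied by `hcov`; otherwise `f` vanishes on it.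
  have hconst : ∀ j, ∀ x ∈ 𝒰.U N j, ∀ y ∈ 𝒰.U N j, f x = f y := by
    intro j x hx y hy
    by_cases hfx : f x = 0
    · by_cases hfy : f y = 0
      · rw [hfx, hfy]
      · obtain ⟨j', hj', h⟩ := hcov y (subset_tsupport _ hfy)
        obtain rfl := 𝒰.eq_of_mem _ _ _ _ hy hj'
        exact h x hx
    · obtain ⟨j', hj', h⟩ := hcov x (subset_tsupport _ hfx)
      obtain rfl := 𝒰.eq_of_mem _ _ _ _ hx hj'
      exact (h y hy).symm
  obtain ⟨s, hs⟩ := hK.elim_finite_subcover (fun j => 𝒰.U N j) (fun j => 𝒰.isOpen _ _)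
    (fun x hx => Set.mem_iUnion.2 ⟨_, (hcov x hx).choose_spec.1⟩)
  -- The value 0 at empty members keeps the coefficients finitely supported.
  let v : ι N → ℤ := fun j => if h : (𝒰.U N j).Nonempty then f h.some else 0
  have hv : ∀ j, ∀ x ∈ 𝒰.U N j, v j = f x := by
    intro j x hx
    have h : (𝒰.U N j).Nonempty := ⟨x, hx⟩
    simp only [v, dif_pos h]
    exact hconst j _ h.some_mem _ hx
  refine ⟨N, Finsupp.onFinset s v fun j hj => ?_, ?_⟩
  · have h : (𝒰.U N j).Nonempty := by
      by_contra h
      exact hj (by simp [v, h])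
    have hx : h.some ∈ tsupport f := subset_tsupport _ (by
      rw [hv j _ h.some_mem] at hj
      exact hj)
    obtain ⟨j', hj', hx'⟩ := Set.mem_iUnion₂.1 (hs hx)
    rwa [𝒰.eq_of_mem _ _ _ _ h.some_mem hx']
  · ext x
    by_cases hx : ∃ j, x ∈ 𝒰.U N j
    · obtain ⟨j, hj⟩ := hx
      rw [𝒰.realize_apply_of_mem hj, Finsupp.onFinset_apply, hv j x hj]
    · rw [𝒰.realize_apply_of_notMem (not_exists.1 hx)]
      by_contra h
      obtain ⟨j, hj, -⟩ := hcov x (subset_tsupport _ (Ne.symm h))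
      exact hx ⟨j, hj⟩

end LevelBasis

namespace Katsura

variable {V : Type*} {A : Matrix V V ℤ} (B : Matrix V V ℤ)

/-! ### Uniqueness of representatives -/

/-- By the cocycle identity, `m - m'` fixes the edge `κ_{m'}(e)` with cocycle value 0. -/
theorem PseudoFree.eq_of_act_eq (hpf : PseudoFree A B) {m m' : ℤ} {e : Edge A}
    (h : e.act B m = e.act B m') (h' : e.cocycle B m = e.cocycle B m') : m = m' := by
  have h1 := Edge.act_add B (m - m') m' e
  have h2 := Edge.cocycle_add B (m - m') m' e
  rw [sub_add_cancel] at h1 h2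
  have := hpf (m - m') (e.act B m') (by rw [← h1, h]) (by linarith)
  linarith

/-- Source, range and lengths recover the two paths of a quadruple; the integer `m` is recovered
from `κ_m(γ)` and `φ(m,γ)` by pseudo-freeness. -/
theorem Quad.next_injective (hpf : PseudoFree A B) :
    Function.Injective (Quad.next B : Quad A → Quad A) := by
  intro q q' h
  have hx : q.x = q'.x := by
    rw [← Quad.next_x B q, h, Quad.next_x]
  have hr : q.rng B = q'.rng B := by rw [← Quad.rng_next, h, Quad.rng_next]
  have hα : q.t.α.length = q'.t.α.length := by
    have := congrArg (fun q : Quad A => q.t.α.length) h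
    simpa using this
  have hβ : q.t.β.length = q'.t.β.length := by
    have := congrArg (fun q : Quad A => q.t.β.length) h
    simpa using this
  refine Quad.ext' B hx hr hα hβ (hpf.eq_of_act_eq B (e := q.x.1 q.t.β.length) ?_ ?_)
  · rw [← Quad.rng_apply, hr, hα, Quad.rng_apply, hx, hβ]
  · have h3 : (q.x.1 q.t.β.length).cocycle B q.t.m = (q'.x.1 q'.t.β.length).cocycle B q'.t.m :=
      congrArg (fun q : Quad A => q.t.m) h
    rw [h3, hx, hβ]

/-- Representatives of one arrow have a common iterate under `next`; equal lengths force equal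
numbers of iterations, which injectivity cancels. This makes the sets of one level disjoint. -/
theorem Quad.eq_of_mk_eq (hpf : PseudoFree A B) {q q' : Quad A} (h : q.mk' B = q'.mk' B)
    (hl : q.t.β.length = q'.t.β.length) : q = q' := by
  obtain ⟨n, n', e⟩ := (Quad.mk_eq_iff B).1 h
  have h1 := congrArg (fun q : Quad A => q.t.β.length) e
  simp only [Quad.iterate_β_length] at h1
  obtain rfl : n = n' := by omega
  exact (Quad.next_injective B hpf).iterate n e

/-! ### Compactness of cylinder sets -/

variable (A) in
theorem finite_outEdges (hA : RowFinite A) (v : V) : {e : Edge A | e.src = v}.Finite := by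
  have h : {e : Edge A | e.src = v} ⊆
      ⋃ w ∈ Function.support (A v), {e : Edge A | e.src = v ∧ e.tgt = w} := by
    rintro e rfl
    exact Set.mem_iUnion₂.2 ⟨e.tgt, e.pos.ne', rfl, rfl⟩
  refine Set.Finite.subset ((hA v).biUnion fun w _ => ?_) h
  refine Set.Finite.of_finite_image (f := Edge.idx) ((Set.finite_Ico 0 (A v w)).subset ?_) ?_
  · rintro _ ⟨e, ⟨rfl, rfl⟩, rfl⟩
    exact ⟨e.idx_nonneg, e.idx_lt⟩
  · rintro e ⟨h1, h2⟩ e' ⟨h1', h2'⟩ h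
    exact Edge.ext (h1.trans h1'.symm) (h2.trans h2'.symm) h

/-- The edges which may occur in position `i` in a path starting at `v`. -/
def reachable (A : Matrix V V ℤ) (v : V) : ℕ → Set (Edge A)
  | 0 => {e | e.src = v}
  | i + 1 => ⋃ f ∈ reachable A v i, {e | e.src = f.tgt}

theorem finite_reachable (hA : RowFinite A) (v : V) (i : ℕ) : (reachable A v i).Finite := by
  induction i with
  | zero => exact finite_outEdges A hA v
  | succ i ih => exact ih.biUnion fun f _ => finite_outEdges A hA f.tgt

theorem isClosed_setOf_isPath :
    IsClosed {x : ℕ → Edge A | ∀ i, (x i).tgt = (x (i + 1)).src} := by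
  simp only [Set.ofPred_forall]
  refine isClosed_iInter fun i => ?_
  have : Continuous fun x : ℕ → Edge A => (x i, x (i + 1)) := by fun_prop
  exact (isClosed_discrete {p : Edge A × Edge A | p.1.tgt = p.2.src}).preimage this

/-- Row-finiteness leaves finitely many edges for each position, so Tychonoff's theorem applies to
the closed set of paths in their product. -/
theorem isCompact_setOf_src (hA : RowFinite A) (v : V) :
    IsCompact {x : InfPath A | x.src = v} := by
  have h : {x : InfPath A | x.src = v} =
      Subtype.val ⁻¹' (Set.pi Set.univ (reachable A v)) := by
    ext x
    constructor
    · intro hx i _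
      induction i with
      | zero => exact hx
      | succ i ih => exact Set.mem_iUnion₂.2 ⟨x.1 i, ih (Set.mem_univ _), (x.2 i).symm⟩
    · exact fun hx => hx 0 (Set.mem_univ _)
  rw [h]
  exact isClosed_setOf_isPath.isClosedEmbedding_subtypeVal.isCompact_preimage
    (isCompact_univ_pi fun i => (finite_reachable hA v i).isCompact)

theorem FinPath.isCompact_Z (hA : RowFinite A) (α : FinPath A) : IsCompact α.Z := by
  rcases α.Z.eq_empty_or_nonempty with h | ⟨x, hx⟩
  · rw [h]; exact isCompact_empty
  have h : α.Z = {x' | x'.src = x.src} ∩ ⋂ i ∈ Set.Iio α.length, {x' | x'.1 i = x.1 i} := by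
    ext x'
    rw [FinPath.mem_Z_iff hx]
    simp
  rw [h]
  refine (isCompact_setOf_src hA x.src).inter_right ?_
  refine isClosed_biInter fun i _ => ?_
  have : Continuous fun x : InfPath A => x.1 i := (continuous_apply i).comp continuous_subtype_val
  exact (isClosed_discrete {x.1 i}).preimage this

theorem exists_infPath (hA : ∀ i j, 0 ≤ A i j) (hArow : ∀ i, ∃ j, A i j ≠ 0) (v : V) :
    ∃ x : InfPath A, x.src = v := by
  choose w hw using hArow
  let nxt : V → Edge A := fun v =>
    ⟨v, w v, 0, le_rfl, lt_of_le_of_ne (hA _ _) (hw v).symm⟩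
  let x : ℕ → Edge A := fun n => Nat.rec (nxt v) (fun _ e => nxt e.tgt) n
  exact ⟨⟨x, fun i => rfl⟩, rfl⟩

/-- Nonempty cylinders make the coefficients at a given level unique and allow `δ₁` to be tested at
every finite path. -/
theorem FinPath.nonempty_Z (hA : ∀ i j, 0 ≤ A i j) (hArow : ∀ i, ∃ j, A i j ≠ 0)
    (α : FinPath A) : α.Z.Nonempty := by
  obtain ⟨y, hy⟩ := exists_infPath hA hArow α.tgt
  exact ⟨_, α.concat_mem y hy⟩

/-! ### The level basis of the kernel groupoid -/

/-- The space of arrows of the kernel groupoid. -/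
abbrev KerArrow (A B : Matrix V V ℤ) : Type _ := {g : Arrow A B // Arrow.ρ g = 0}

variable (A) in
/-- The triples `(α, m, β)` with `|α| = |β| = n`. -/
abbrev LTriple (n : ℕ) : Type _ := {t : Triple A // t.α.length = n ∧ t.β.length = n}

/-- The arrow `[α, m, β; x]` of the kernel groupoid. -/
def LTriple.arrow {n : ℕ} (t : LTriple A n) (x : InfPath A) (hx : x ∈ t.1.β.Z) : KerArrow A B :=
  ⟨(Quad.mk t.1 x hx).mk' B, by
    change ((t.1.α.length : ℤ) - t.1.β.length) = 0
    rw [t.2.1, t.2.2, sub_self]⟩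

/-- The set `Z(α, m, β; Z(β))` as a subset of the kernel groupoid. -/
def LTriple.set {n : ℕ} (t : LTriple A n) : Set (KerArrow A B) :=
  {g | g.1 ∈ Arrow.basicSet B t.1}

variable {B}

theorem LTriple.mem_set_iff {n : ℕ} {t : LTriple A n} {g : KerArrow A B} :
    g ∈ t.set B ↔ ∃ x hx, g = t.arrow B x hx := by
  constructor
  · rintro ⟨x, hx, h⟩
    exact ⟨x, hx, Subtype.ext h⟩
  · rintro ⟨x, hx, rfl⟩
    exact ⟨x, hx, rfl⟩

theorem LTriple.s_mem {n : ℕ} {t : LTriple A n} {g : KerArrow A B} (hg : g ∈ t.set B) :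
    g.1.s ∈ t.1.β.Z := by
  obtain ⟨x, hx, rfl⟩ := LTriple.mem_set_iff.1 hg
  exact hx

theorem LTriple.r_mem {n : ℕ} {t : LTriple A n} {g : KerArrow A B} (hg : g ∈ t.set B) :
    g.1.r ∈ t.1.α.Z := by
  obtain ⟨x, hx, rfl⟩ := LTriple.mem_set_iff.1 hg
  exact Quad.rng_mem B ⟨t.1, x, hx⟩

theorem LTriple.eq_of_mem (hpf : PseudoFree A B) {n : ℕ} {t t' : LTriple A n} {g : KerArrow A B}
    (h : g ∈ t.set B) (h' : g ∈ t'.set B) : t = t' := by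
  obtain ⟨x, hx, e⟩ := h
  obtain ⟨x', hx', e'⟩ := h'
  have := Quad.eq_of_mk_eq B hpf (e.symm.trans e') (t.2.2.trans t'.2.2.symm)
  exact Subtype.ext (congrArg Quad.t this)

theorem LTriple.isOpen_set {n : ℕ} (t : LTriple A n) : IsOpen (t.set B) :=
  (Arrow.isOpen_basicSet t.1).preimage continuous_subtype_val

theorem LTriple.exists_subset {n k : ℕ} {t : LTriple A n} {g : KerArrow A B} (hnk : n ≤ k)
    (hg : g ∈ t.set B) : ∃ t' : LTriple A k, g ∈ t'.set B ∧ t'.set B ⊆ t.set B := by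
  obtain ⟨x, hx, e⟩ := hg
  let q : Quad A := ⟨t.1, x, hx⟩
  refine ⟨⟨((Quad.next B)^[k - n] q).t, ?_, ?_⟩, ?_, ?_⟩
  · rw [Quad.iterate_α_length, t.2.1]; omega
  · rw [Quad.iterate_β_length, t.2.2]; omega
  · change g.1 ∈ Arrow.basicSet B ((Quad.next B)^[k - n] q).t
    rw [e, ← Quad.mk_iterate B (k - n)]
    exact Arrow.mk_mem_basicSet _
  · exact fun g hg => Arrow.basicSet_anti q (Nat.zero_le (k - n)) hg

theorem LTriple.exists_mem {W : Set (KerArrow A B)} (hW : IsOpen W) {g : KerArrow A B}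
    (hg : g ∈ W) : ∃ n, ∃ t : LTriple A n, g ∈ t.set B ∧ t.set B ⊆ W := by
  obtain ⟨S, hS, rfl⟩ := hW
  obtain ⟨g, hρ⟩ := g
  obtain ⟨q, rfl⟩ := Quot.exists_rep g
  obtain ⟨n, hn⟩ := Arrow.exists_basicSet hS q hg
  have hl : q.t.α.length = q.t.β.length := by
    have : (q.t.α.length : ℤ) - q.t.β.length = 0 := hρ
    omega
  refine ⟨q.t.β.length + n, ⟨((Quad.next B)^[n] q).t, ?_, ?_⟩, ?_, fun g hg => hn hg⟩
  · rw [Quad.iterate_α_length, hl]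
  · rw [Quad.iterate_β_length]
  · change q.mk' B ∈ Arrow.basicSet B ((Quad.next B)^[n] q).t
    rw [← Quad.mk_iterate B n]
    exact Arrow.mk_mem_basicSet _

variable (B) in
theorem LTriple.continuous_arrow {n : ℕ} (t : LTriple A n) :
    Continuous fun x : t.1.β.Z => t.arrow B x.1 x.2 := by
  refine Continuous.subtype_mk ?_ _
  refine continuous_def.2 fun S hS => isOpen_iff_forall_mem_open.2 fun x hx => ?_
  obtain ⟨n, hn⟩ := Arrow.exists_basicSet hS (⟨t.1, x.1, x.2⟩ : Quad A) hx
  let q : Quad A := ⟨t.1, x.1, x.2⟩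
  refine ⟨Subtype.val ⁻¹' ((Quad.next B)^[n] q).t.β.Z, ?_,
    (FinPath.isOpen_Z _).preimage continuous_subtype_val, ?_⟩
  · rintro ⟨y, hy⟩ hy'
    refine hn ⟨y, hy', ?_⟩
    -- The arrow over `y` given by the extended triple also belongs to the set of `t`, hence is the
    -- arrow of `t` over its source `y`.
    have h1 := Arrow.basicSet_anti (B := B) q (Nat.zero_le n) ⟨y, hy', rfl⟩
    obtain ⟨y', h', e⟩ := h1
    obtain rfl : y = y' := congrArg Arrow.s e
    exact e.symm
  · have := ((Quad.next B)^[n] q).mem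
    rwa [Quad.iterate_x] at this

theorem LTriple.isCompact_set (hA : RowFinite A) {n : ℕ} (t : LTriple A n) :
    IsCompact (t.set B) := by
  have : CompactSpace t.1.β.Z := isCompact_iff_compactSpace.1 (FinPath.isCompact_Z hA _)
  have h : t.set B = Set.range fun x : t.1.β.Z => t.arrow B x.1 x.2 := by
    ext g
    rw [LTriple.mem_set_iff]
    simp [eq_comm]
  rw [h]
  exact isCompact_range (t.continuous_arrow B)

/-- The basis of the kernel groupoid. -/
def arrowBasis (hA : RowFinite A) (hpf : PseudoFree A B) :
    LevelBasis (KerArrow A B) (LTriple A) where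
  U _ t := t.set B
  isOpen _ t := t.isOpen_set
  isCompact _ t := t.isCompact_set hA
  eq_of_mem _ _ _ _ h h' := LTriple.eq_of_mem hpf h h'
  exists_subset _ _ _ _ hnk h := LTriple.exists_subset hnk h
  exists_mem _ _ hW hx := LTriple.exists_mem hW hx

theorem arrowBasis_nonempty (hA : ∀ i j, 0 ≤ A i j) (hArow : ∀ i, ∃ j, A i j ≠ 0)
    (hAfin : RowFinite A) (hpf : PseudoFree A B) (n : ℕ) (t : LTriple A n) :
    ((arrowBasis hAfin hpf).U n t).Nonempty := by
  obtain ⟨x, hx⟩ := t.1.β.nonempty_Z hA hArow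
  exact ⟨_, LTriple.mem_set_iff.2 ⟨x, hx, rfl⟩⟩

/-! ### Source and range on the members of the basis -/

theorem LTriple.bijOn_s {n : ℕ} (t : LTriple A n) :
    Set.BijOn (kerGroupoid A B).s (t.set B) t.1.β.Z := by
  refine ⟨fun g hg => LTriple.s_mem hg, fun g hg g' hg' h => ?_, fun x hx => ?_⟩
  · obtain ⟨x, hx, rfl⟩ := LTriple.mem_set_iff.1 hg
    obtain ⟨x', hx', rfl⟩ := LTriple.mem_set_iff.1 hg'
    obtain rfl : x = x' := h
    rfl
  · exact ⟨t.arrow B x hx, LTriple.mem_set_iff.2 ⟨x, hx, rfl⟩, rfl⟩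

theorem LTriple.bijOn_r {n : ℕ} (t : LTriple A n) :
    Set.BijOn (kerGroupoid A B).r (t.set B) t.1.α.Z := by
  refine ⟨fun g hg => LTriple.r_mem hg, fun g hg g' hg' h => ?_, fun y hy => ?_⟩
  · obtain ⟨x, hx, rfl⟩ := LTriple.mem_set_iff.1 hg
    obtain ⟨x', hx', rfl⟩ := LTriple.mem_set_iff.1 hg'
    -- The inverse quadruple depends only on `t` and the range, and its own range is the original
    -- source.
    have h1 : (Quad.mk t.1 x hx).inv B = (Quad.mk t.1 x' hx').inv B := Quad.ext rfl h
    obtain rfl : x = x' := by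
      have h2 := Quad.rng_inv B (Quad.mk t.1 x hx)
      have h3 := Quad.rng_inv B (Quad.mk t.1 x' hx')
      rw [h1] at h2
      exact h2.symm.trans h3
    rfl
  · let q : Quad A := ⟨⟨t.1.β, -t.1.m, t.1.α, t.1.tgt_eq.symm⟩, y, hy⟩
    have hq : q.inv B = ⟨t.1, q.rng B, q.rng_mem B⟩ :=
      Quad.ext (Triple.ext rfl (neg_neg _) rfl) rfl
    refine ⟨t.arrow B (q.rng B) (q.rng_mem B), LTriple.mem_set_iff.2 ⟨_, _, rfl⟩, ?_⟩
    have h := Quad.rng_inv B q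
    rw [hq] at h
    exact h

theorem continuous_ker_r : Continuous fun g : KerArrow A B => g.1.r := by
  have h : (fun g : KerArrow A B => g.1.r) = fun g => (Arrow.inv g.1).s :=
    funext fun g => (Arrow.s_inv g.1).symm
  rw [h]
  exact Arrow.continuous_s.comp (Arrow.continuous_inv.comp continuous_subtype_val)

/-! ### Composable pairs of triples -/

variable (A) in
/-- Composable pairs of triples `(α, m, β)`, `(β, m', γ)` with `|α| = |β| = |γ| = n`. -/
abbrev LPair (n : ℕ) : Type _ := {p : LTriple A n × LTriple A n // p.1.1.β = p.2.1.α}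

/-- The triple `(α, m + m', γ)`. -/
def LPair.comp {n : ℕ} (p : LPair A n) : LTriple A n :=
  ⟨⟨p.1.1.1.α, p.1.1.1.m + p.1.2.1.m, p.1.2.1.β,
    p.1.1.1.tgt_eq.trans (p.2 ▸ p.1.2.1.tgt_eq)⟩, p.1.1.2.1, p.1.2.2.2⟩

variable (B) in
/-- The composable pairs of arrows with one arrow in each of the two members of the basis. -/
def LPair.set {n : ℕ} (p : LPair A n) : Set (kerGroupoid A B).Pairs :=
  {g | g.1.1 ∈ p.1.1.set B ∧ g.1.2 ∈ p.1.2.set B}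

variable (B) in
theorem LPair.r_arrow_mem {n : ℕ} (p : LPair A n) (x : InfPath A) (hx : x ∈ p.1.2.1.β.Z) :
    (p.1.2.arrow B x hx).1.r ∈ p.1.1.1.β.Z :=
  p.2 ▸ LTriple.r_mem (LTriple.mem_set_iff.2 ⟨x, hx, rfl⟩)

variable (B) in
/-- The element of `p.set` over a point of the unit space. -/
def LPair.arrows {n : ℕ} (p : LPair A n) (x : InfPath A) (hx : x ∈ p.1.2.1.β.Z) :
    (kerGroupoid A B).Pairs :=
  ⟨(p.1.1.arrow B (p.1.2.arrow B x hx).1.r (p.r_arrow_mem B x hx), p.1.2.arrow B x hx), rfl⟩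

theorem LPair.arrows_mem {n : ℕ} (p : LPair A n) (x : InfPath A) (hx : x ∈ p.1.2.1.β.Z) :
    p.arrows B x hx ∈ p.set B :=
  ⟨LTriple.mem_set_iff.2 ⟨_, _, rfl⟩, LTriple.mem_set_iff.2 ⟨_, _, rfl⟩⟩

theorem LPair.mem_set_iff {n : ℕ} {p : LPair A n} {g : (kerGroupoid A B).Pairs} :
    g ∈ p.set B ↔ ∃ x hx, g = p.arrows B x hx := by
  constructor
  · obtain ⟨⟨g, h⟩, c⟩ := g
    rintro ⟨h1, h2⟩
    obtain ⟨x, hx, rfl⟩ := LTriple.mem_set_iff.1 h2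
    obtain ⟨y, hy, rfl⟩ := LTriple.mem_set_iff.1 h1
    obtain rfl : y = (p.1.2.arrow B x hx).1.r := c
    exact ⟨x, hx, rfl⟩
  · rintro ⟨x, hx, rfl⟩
    exact p.arrows_mem x hx

theorem LPair.continuous_arrows {n : ℕ} (p : LPair A n) :
    Continuous fun x : p.1.2.1.β.Z => p.arrows B x.1 x.2 := by
  have h2 := p.1.2.continuous_arrow B
  refine Continuous.subtype_mk (Continuous.prodMk ?_ h2) _
  exact (p.1.1.continuous_arrow B).comp
    (f := fun x : p.1.2.1.β.Z => (⟨(p.1.2.arrow B x.1 x.2).1.r, p.r_arrow_mem B x.1 x.2⟩ : p.1.1.1.β.Z))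
    ((continuous_ker_r.comp h2).subtype_mk _)

theorem LPair.isCompact_set (hA : RowFinite A) {n : ℕ} (p : LPair A n) :
    IsCompact (p.set B) := by
  have : CompactSpace p.1.2.1.β.Z := isCompact_iff_compactSpace.1 (FinPath.isCompact_Z hA _)
  have h : p.set B = Set.range fun x : p.1.2.1.β.Z => p.arrows B x.1 x.2 := by
    ext g
    rw [LPair.mem_set_iff]
    simp [eq_comm]
  rw [h]
  exact isCompact_range p.continuous_arrows

theorem LPair.isOpen_set {n : ℕ} (p : LPair A n) : IsOpen (p.set B) :=
  (p.1.1.isOpen_set.preimage (continuous_fst.comp continuous_subtype_val)).inter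
    (p.1.2.isOpen_set.preimage (continuous_snd.comp continuous_subtype_val))

/-- Both paths are the initial segment of length `n` of the common point `s(g) = r(h)`. So
composability of arrows is composability of triples once the levels agree. -/
theorem LPair.composable {n : ℕ} {t t' : LTriple A n} {g : (kerGroupoid A B).Pairs}
    (h : g.1.1 ∈ t.set B) (h' : g.1.2 ∈ t'.set B) : t.1.β = t'.1.α := by
  refine FinPath.eq_of_mem (LTriple.s_mem h) ?_ (t.2.2.trans t'.2.1.symm)
  have := LTriple.r_mem h'
  rwa [show g.1.2.1.r = g.1.1.1.s from g.2.symm] at this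

theorem LPair.exists_subset {n k : ℕ} {p : LPair A n} {g : (kerGroupoid A B).Pairs} (hnk : n ≤ k)
    (hg : g ∈ p.set B) : ∃ p' : LPair A k, g ∈ p'.set B ∧ p'.set B ⊆ p.set B := by
  obtain ⟨t, ht, hts⟩ := LTriple.exists_subset hnk hg.1
  obtain ⟨t', ht', hts'⟩ := LTriple.exists_subset hnk hg.2
  exact ⟨⟨(t, t'), LPair.composable ht ht'⟩, ⟨ht, ht'⟩, fun g hg => ⟨hts hg.1, hts' hg.2⟩⟩

theorem LPair.exists_mem {W : Set (kerGroupoid A B).Pairs} (hW : IsOpen W)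
    {g : (kerGroupoid A B).Pairs} (hg : g ∈ W) :
    ∃ n, ∃ p : LPair A n, g ∈ p.set B ∧ p.set B ⊆ W := by
  obtain ⟨S, hS, rfl⟩ := hW
  obtain ⟨S₁, S₂, h₁, h₂, hg₁, hg₂, hsub⟩ := isOpen_prod_iff.1 hS g.1.1 g.1.2 hg
  obtain ⟨n₁, t₁, ht₁, hts₁⟩ := LTriple.exists_mem h₁ hg₁
  obtain ⟨n₂, t₂, ht₂, hts₂⟩ := LTriple.exists_mem h₂ hg₂
  obtain ⟨t, ht, hts⟩ := LTriple.exists_subset (le_max_left n₁ n₂) ht₁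
  obtain ⟨t', ht', hts'⟩ := LTriple.exists_subset (le_max_right n₁ n₂) ht₂
  exact ⟨_, ⟨(t, t'), LPair.composable ht ht'⟩, ⟨ht, ht'⟩,
    fun g hg => hsub ⟨hts₁ (hts hg.1), hts₂ (hts' hg.2)⟩⟩

/-- The basis of the space of composable pairs of the kernel groupoid. -/
def pairBasis (hA : RowFinite A) (hpf : PseudoFree A B) :
    LevelBasis (kerGroupoid A B).Pairs (LPair A) where
  U _ p := p.set B
  isOpen _ p := p.isOpen_set
  isCompact _ p := p.isCompact_set hA
  eq_of_mem _ _ _ _ h h' := Subtype.ext (Prod.ext (LTriple.eq_of_mem hpf h.1 h'.1)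
    (LTriple.eq_of_mem hpf h.2 h'.2))
  exists_subset _ _ _ _ hnk h := LPair.exists_subset hnk h
  exists_mem _ _ hW hx := LPair.exists_mem hW hx

theorem LPair.bijOn_d₀ {n : ℕ} (p : LPair A n) :
    Set.BijOn (kerGroupoid A B).d₀ (p.set B) (p.1.2.set B) := by
  refine ⟨fun g hg => hg.2, fun g hg g' hg' h => ?_, fun g hg => ?_⟩
  · obtain ⟨x, hx, rfl⟩ := LPair.mem_set_iff.1 hg
    obtain ⟨x', hx', rfl⟩ := LPair.mem_set_iff.1 hg'
    obtain rfl : x = x' := congrArg (fun g : KerArrow A B => g.1.s) h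
    rfl
  · obtain ⟨x, hx, rfl⟩ := LTriple.mem_set_iff.1 hg
    exact ⟨_, p.arrows_mem x hx, rfl⟩

theorem LPair.bijOn_d₂ {n : ℕ} (p : LPair A n) :
    Set.BijOn (kerGroupoid A B).d₂ (p.set B) (p.1.1.set B) := by
  refine ⟨fun g hg => hg.1, ?_, fun g hg => ?_⟩
  · rintro ⟨⟨g, h⟩, c⟩ hg ⟨⟨g', h'⟩, c'⟩ hg' (e : g = g')
    subst e
    obtain rfl : h = h' := p.1.2.bijOn_r.injOn hg.2 hg'.2 (c.symm.trans c')
    rfl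
  · have h1 : g.1.s ∈ p.1.2.1.α.Z := p.2 ▸ LTriple.s_mem hg
    obtain ⟨h, hh, e⟩ := (p.1.2.bijOn_r (B := B)).surjOn h1
    exact ⟨⟨(g, h), e.symm⟩, ⟨hg, hh⟩, rfl⟩

theorem LPair.d₁_arrows {n : ℕ} (p : LPair A n) (x : InfPath A) (hx : x ∈ p.1.2.1.β.Z) :
    (kerGroupoid A B).d₁ (p.arrows B x hx) = p.comp.arrow B x hx :=
  Subtype.ext (Arrow.mul_mk (B := B) ⟨p.1.1.1, _, _⟩ ⟨p.1.2.1, x, hx⟩ p.2 rfl)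

theorem LPair.bijOn_d₁ {n : ℕ} (p : LPair A n) :
    Set.BijOn (kerGroupoid A B).d₁ (p.set B) (p.comp.set B) := by
  refine ⟨fun g hg => ?_, fun g hg g' hg' h => ?_, fun g hg => ?_⟩
  · obtain ⟨x, hx, rfl⟩ := LPair.mem_set_iff.1 hg
    rw [d₁_arrows]
    exact LTriple.mem_set_iff.2 ⟨_, _, rfl⟩
  · obtain ⟨x, hx, rfl⟩ := LPair.mem_set_iff.1 hg
    obtain ⟨x', hx', rfl⟩ := LPair.mem_set_iff.1 hg'
    rw [d₁_arrows, d₁_arrows] at h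
    obtain rfl : x = x' := congrArg (fun g : KerArrow A B => g.1.s) h
    rfl
  · obtain ⟨x, hx, rfl⟩ := LTriple.mem_set_iff.1 hg
    exact ⟨_, p.arrows_mem x hx, p.d₁_arrows x hx⟩

/-! ### The boundary maps on indicator functions -/

variable (hA : RowFinite A) (hpf : PseudoFree A B)

theorem δ₂_ind {n : ℕ} (p : LPair A n) :
    (kerGroupoid A B).δ₂ ((pairBasis hA hpf).ind n p) =
      ⇑((arrowBasis hA hpf).ind n p.1.2 - (arrowBasis hA hpf).ind n p.comp +
        (arrowBasis hA hpf).ind n p.1.1) := by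
  have h0 := pushforward_eq_indicator (kerGroupoid A B).locInj_d₀ ((pairBasis hA hpf).ind n p)
    rfl p.bijOn_d₀
  have h1 := pushforward_eq_indicator (kerGroupoid A B).locInj_d₁ ((pairBasis hA hpf).ind n p)
    rfl p.bijOn_d₁
  have h2 := pushforward_eq_indicator (kerGroupoid A B).locInj_d₂ ((pairBasis hA hpf).ind n p)
    rfl p.bijOn_d₂
  simp only [EtaleGroupoid.δ₂, AddMonoidHom.add_apply, AddMonoidHom.sub_apply, h0, h1, h2]
  rfl

theorem δ₁_ind {n : ℕ} (t : LTriple A n) :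
    (kerGroupoid A B).δ₁ ((arrowBasis hA hpf).ind n t) =
      t.1.β.Z.indicator 1 - t.1.α.Z.indicator 1 := by
  have h0 := pushforward_eq_indicator (kerGroupoid A B).locInj_s ((arrowBasis hA hpf).ind n t)
    rfl t.bijOn_s
  have h1 := pushforward_eq_indicator (kerGroupoid A B).locInj_r ((arrowBasis hA hpf).ind n t)
    rfl t.bijOn_r
  simp only [EtaleGroupoid.δ₁, AddMonoidHom.sub_apply, h0, h1]

/-! ### Passing to the next level -/

/-- The case `x = M / a` of Hermite's identity, with the integer `M` as value. -/
theorem sum_range_add_ediv {a : ℕ} (ha : 0 < a) (M : ℤ) :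
    ∑ i ∈ Finset.range a, (M + i) / (a : ℤ) = M := by
  have ha' : (a : ℤ) ≠ 0 := by exact_mod_cast ha.ne'
  -- Shifting `M` by one trades the term `M / a` for `(M + a) / a`, which is larger by one.
  have hstep : ∀ M : ℤ, ∑ i ∈ Finset.range a, (M + 1 + i) / (a : ℤ) =
      ∑ i ∈ Finset.range a, (M + i) / (a : ℤ) + 1 := by
    intro M
    have h := Finset.sum_range_sub (fun i : ℕ => (M + i) / (a : ℤ)) a
    rw [Finset.sum_sub_distrib, Int.add_ediv_of_dvd_right dvd_rfl, Int.ediv_self ha'] at h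
    have h2 : ∑ i ∈ Finset.range a, (M + 1 + i) / (a : ℤ) =
        ∑ i ∈ Finset.range a, (M + ((i + 1 : ℕ) : ℤ)) / (a : ℤ) :=
      Finset.sum_congr rfl fun i _ => by congr 1; push_cast; ring
    rw [h2]
    simp only [Nat.cast_zero, add_zero] at h
    linarith
  induction M using Int.induction_on with
  | zero =>
    refine Finset.sum_eq_zero fun i hi => ?_
    rw [zero_add]
    exact Int.ediv_eq_zero_of_lt (by positivity) (by exact_mod_cast Finset.mem_range.1 hi)
  | succ M ih => rw [hstep, ih]
  | pred M ih =>
    have h := hstep (-(M : ℤ) - 1)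
    rw [sub_add_cancel, ih] at h
    linarith

/-- The sum of `φ(m, e)` over all edges `e` from `v` to `w` is `m B_{v,w}`. -/
theorem sum_cocycle (hA0 : ∀ i j, 0 ≤ A i j) (hAB : ∀ i j, A i j = 0 → B i j = 0) (v w : V)
    (m : ℤ) (S : Finset (Edge A)) (hS : ∀ e, e ∈ S ↔ e.src = v ∧ e.tgt = w) :
    ∑ e ∈ S, e.cocycle B m = m * B v w := by
  -- Without edges from `v` to `w` the sum is empty, and `B v w = 0` by hypothesis.
  rcases (hA0 v w).eq_or_lt with h0 | hpos
  · rw [hAB v w h0.symm, mul_zero]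
    refine Finset.sum_eq_zero fun e he => ?_
    obtain ⟨rfl, rfl⟩ := (hS e).1 he
    exact absurd h0 e.pos.ne
  · obtain ⟨a, ha⟩ := Int.eq_ofNat_of_zero_le hpos.le
    have ha0 : 0 < a := by omega
    rw [← sum_range_add_ediv ha0 (m * B v w)]
    refine Finset.sum_bij (fun e _ => e.idx.toNat) ?_ ?_ ?_ ?_
    · intro e he
      obtain ⟨rfl, rfl⟩ := (hS e).1 he
      have := e.idx_lt
      have := e.idx_nonneg
      rw [Finset.mem_range]
      omega
    · intro e he e' he' h
      obtain ⟨h1, h2⟩ := (hS e).1 he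
      obtain ⟨h1', h2'⟩ := (hS e').1 he'
      have := e.idx_nonneg
      have := e'.idx_nonneg
      exact Edge.ext (h1.trans h1'.symm) (h2.trans h2'.symm) (by omega)
    · intro i hi
      rw [Finset.mem_range] at hi
      exact ⟨⟨v, w, i, by positivity, by omega⟩, (hS _).2 ⟨rfl, rfl⟩, by simp⟩
    · intro e he
      obtain ⟨rfl, rfl⟩ := (hS e).1 he
      rw [Edge.cocycle, ha, Int.toNat_of_nonneg e.idx_nonneg]

variable (B) in
/-- The triple `(α κ_m(γ), φ(m,γ), β γ)`. -/
def LTriple.snoc {n : ℕ} (t : LTriple A n) (γ : Edge A) (h : γ.src = t.1.β.tgt) :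
    LTriple A (n + 1) :=
  ⟨t.1.snoc B γ h, by
    refine ⟨(FinPath.length_snoc t.1.α (γ.act B t.1.m) (h.trans t.1.tgt_eq.symm)).trans ?_,
      (FinPath.length_snoc t.1.β γ h).trans ?_⟩
    · rw [t.2.1]
    · rw [t.2.2]⟩

/-- An arrow is unchanged when its triple is extended along the next edge of its source. Hence the
extensions of `t` partition its set according to that edge. -/
theorem LTriple.mem_set_snoc {n : ℕ} {t : LTriple A n} {γ : Edge A} (h : γ.src = t.1.β.tgt)
    {g : KerArrow A B} : g ∈ (t.snoc B γ h).set B ↔ g ∈ t.set B ∧ g.1.s.1 n = γ := by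
  constructor
  · rintro ⟨x, hx, e⟩
    obtain ⟨h1, h2⟩ := FinPath.mem_of_snoc_mem h hx
    rw [t.2.2] at h2
    refine ⟨⟨x, h1, ?_⟩, ?_⟩
    · rw [e]
      exact (Quot.sound ⟨rfl, _, _, rfl⟩).symm
    · rw [e]
      exact h2
  · rintro ⟨⟨x, hx, e⟩, hγ⟩
    rw [e] at hγ
    have hγ' : x.1 t.1.β.length = γ := by rw [t.2.2]; exact hγ
    subst hγ'
    exact ⟨x, FinPath.snoc_mem hx, e.trans (Quot.sound ⟨rfl, _, _, rfl⟩)⟩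

/-- The map `1_{Z(α,m,β)} ↦ m 1_{r(β)}`. -/
noncomputable def vertexSum (A : Matrix V V ℤ) (n : ℕ) : (LTriple A n →₀ ℤ) →ₗ[ℤ] (V →₀ ℤ) :=
  Finsupp.linearCombination ℤ fun t => Finsupp.single t.1.β.tgt t.1.m

section

variable (hA : RowFinite A) (hB : RowFinite B) (hpf : PseudoFree A B)

/-- The indicator of `t` is the sum of those of its one-edge extensions, and `sum_cocycle`
identifies the sum of their integers, vertex by vertex, with row `r(β)` of `B` times `m`. This is
where the matrix `B` enters the homology. -/
theorem exists_refine_single (hA0 : ∀ i j, 0 ≤ A i j)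
    (hAB : ∀ i j, A i j = 0 → B i j = 0) {n : ℕ} (t : LTriple A n) :
    ∃ y, (arrowBasis hA hpf).realize (n + 1) y = (arrowBasis hA hpf).ind n t ∧
      vertexSum A (n + 1) y = connecting B hB (vertexSum A n (Finsupp.single t 1)) := by
  classical
  let _ : Fintype {e : Edge A // e.src = t.1.β.tgt} := (finite_outEdges A hA t.1.β.tgt).fintype
  refine ⟨∑ γ : {e : Edge A // e.src = t.1.β.tgt}, Finsupp.single (t.snoc B γ.1 γ.2) 1, ?_, ?_⟩
  · ext g
    rw [map_sum, CompactlySupportedContinuousMap.sum_apply]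
    simp only [LevelBasis.realize_single, one_smul, LevelBasis.coe_ind]
    change ∑ γ : {e : Edge A // e.src = t.1.β.tgt}, ((t.snoc B γ.1 γ.2).set B).indicator 1 g =
      (t.set B).indicator 1 g
    by_cases hg : g ∈ t.set B
    · have hsrc : (g.1.s.1 n).src = t.1.β.tgt := by
        have := FinPath.src_apply_of_mem (LTriple.s_mem hg)
        rwa [t.2.2] at this
      rw [Finset.sum_eq_single ⟨g.1.s.1 n, hsrc⟩]
      · rw [Set.indicator_of_mem hg, Set.indicator_of_mem]
        exact (LTriple.mem_set_snoc hsrc).2 ⟨hg, rfl⟩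
      · intro γ _ hγ
        refine Set.indicator_of_notMem (fun h => hγ (Subtype.ext ?_)) _
        exact ((LTriple.mem_set_snoc γ.2).1 h).2.symm
      · intro h
        exact absurd (Finset.mem_univ _) h
    · rw [Set.indicator_of_notMem hg]
      exact Finset.sum_eq_zero fun γ _ =>
        Set.indicator_of_notMem (fun h => hg ((LTriple.mem_set_snoc γ.2).1 h).1) _
  · rw [map_sum]
    simp only [vertexSum, Finsupp.linearCombination_single, one_smul, connecting]
    ext w
    rw [Finsupp.finsetSum_apply, Finsupp.smul_apply, Finsupp.ofSupportFinite_coe, smul_eq_mul,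
      ← sum_cocycle hA0 hAB t.1.β.tgt w t.1.m
        ((Finset.univ.map (Function.Embedding.subtype fun e : Edge A => e.src = t.1.β.tgt)).filter
          fun e => e.tgt = w) (by simp)]
    rw [Finset.sum_filter, Finset.sum_map]
    refine Finset.sum_congr rfl fun γ _ => ?_
    rw [Finsupp.single_apply]
    rfl

theorem exists_refine_succ (hA0 : ∀ i j, 0 ≤ A i j)
    (hAB : ∀ i j, A i j = 0 → B i j = 0) {n : ℕ} (x : LTriple A n →₀ ℤ) :
    ∃ y, (arrowBasis hA hpf).realize (n + 1) y = (arrowBasis hA hpf).realize n x ∧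
      vertexSum A (n + 1) y = connecting B hB (vertexSum A n x) := by
  induction x using Finsupp.induction_linear with
  | zero => exact ⟨0, by simp, by simp⟩
  | add x x' ih ih' =>
    obtain ⟨y, h1, h2⟩ := ih
    obtain ⟨y', h1', h2'⟩ := ih'
    exact ⟨y + y', by rw [map_add, map_add, h1, h1'], by simp only [map_add, h2, h2']⟩
  | single t c =>
    obtain ⟨y, h1, h2⟩ := exists_refine_single hA hB hpf hA0 hAB t
    refine ⟨c • y, ?_, ?_⟩
    · rw [map_smul, h1, LevelBasis.realize_single]
    · rw [map_smul, h2, ← map_smul, ← map_smul, Finsupp.smul_single, smul_eq_mul, mul_one]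

theorem exists_refine (hA0 : ∀ i j, 0 ≤ A i j)
    (hAB : ∀ i j, A i j = 0 → B i j = 0) {n k : ℕ} (hnk : n ≤ k) (x : LTriple A n →₀ ℤ) :
    ∃ y, (arrowBasis hA hpf).realize k y = (arrowBasis hA hpf).realize n x ∧
      vertexSum A k y = (connecting B hB ^ (k - n)) (vertexSum A n x) := by
  induction k, hnk using Nat.le_induction with
  | base => exact ⟨x, rfl, by simp⟩
  | succ k hk ih =>
    obtain ⟨y, h1, h2⟩ := ih
    obtain ⟨y', h1', h2'⟩ := exists_refine_succ hA hB hpf hA0 hAB y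
    refine ⟨y', h1'.trans h1, ?_⟩
    rw [h2', h2, Nat.succ_sub hk, pow_succ', Module.End.mul_apply]

/-! ### Equality in the inductive limit -/

theorem toLimit_pow {n k : ℕ} (hnk : n ≤ k) (x : V →₀ ℤ) :
    toLimit B hB k ((connecting B hB ^ (k - n)) x) = toLimit B hB n x :=
  Module.DirectLimit.of_f (f := fun i j (_ : i ≤ j) => connecting B hB ^ (j - i)) (hij := hnk)

theorem exists_pow_eq_zero {n : ℕ} {x : V →₀ ℤ} (h : toLimit B hB n x = 0) :
    ∃ k, n ≤ k ∧ (connecting B hB ^ (k - n)) x = 0 := by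
  have : DirectedSystem (fun _ : ℕ => V →₀ ℤ)
      (fun i j (_ : i ≤ j) => ⇑(connecting B hB ^ (j - i))) :=
    { map_self := fun i x => by simp
      map_map := fun i j k hij hjk x => by
        rw [← Module.End.mul_apply, ← pow_add]
        congr 2
        omega }
  obtain ⟨k, hk, e⟩ := Module.DirectLimit.of.zero_exact h
  exact ⟨k, hk, e⟩

end

section

variable (hA : RowFinite A) (hB : RowFinite B) (hpf : PseudoFree A B)
  (hA0 : ∀ i j, 0 ≤ A i j) (hArow : ∀ i, ∃ j, A i j ≠ 0) (hAB : ∀ i j, A i j = 0 → B i j = 0)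

/-! ### The homomorphism to the inductive limit -/

/-- Refined to a common level, two expressions of one function have the same coefficients, and
refinement does not change the value in the limit. -/
theorem toLimit_vertexSum_eq (hA0 : ∀ i j, 0 ≤ A i j) (hArow : ∀ i, ∃ j, A i j ≠ 0)
    (hAB : ∀ i j, A i j = 0 → B i j = 0) {n k : ℕ} {x : LTriple A n →₀ ℤ} {y : LTriple A k →₀ ℤ}
    (h : (arrowBasis hA hpf).realize n x = (arrowBasis hA hpf).realize k y) :
    toLimit B hB n (vertexSum A n x) = toLimit B hB k (vertexSum A k y) := by
  obtain ⟨x', h1, h2⟩ := exists_refine hA hB hpf hA0 hAB (le_max_left n k) x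
  obtain ⟨y', h1', h2'⟩ := exists_refine hA hB hpf hA0 hAB (le_max_right n k) y
  have e : x' = y' := (arrowBasis hA hpf).realize_injective
    (arrowBasis_nonempty hA0 hArow hA hpf) _ (by rw [h1, h1', h])
  rw [← toLimit_pow hB (le_max_left n k), ← toLimit_pow hB (le_max_right n k), ← h2, ← h2', e]

/-- The value at `f` of the homomorphism `limitHom`. -/
noncomputable def limitValue (f : C_c(KerArrow A B, ℤ)) : IndLimit B hB :=
  toLimit B hB ((arrowBasis hA hpf).exists_realize f).choose
    (vertexSum A _ ((arrowBasis hA hpf).exists_realize f).choose_spec.choose)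

theorem limitValue_realize (hA0 : ∀ i j, 0 ≤ A i j) (hArow : ∀ i, ∃ j, A i j ≠ 0)
    (hAB : ∀ i j, A i j = 0 → B i j = 0) {n : ℕ} (x : LTriple A n →₀ ℤ) :
    limitValue hA hB hpf ((arrowBasis hA hpf).realize n x) =
      toLimit B hB n (vertexSum A n x) :=
  toLimit_vertexSum_eq hA hB hpf hA0 hArow hAB
    ((arrowBasis hA hpf).exists_realize _).choose_spec.choose_spec

theorem limitValue_add (hA0 : ∀ i j, 0 ≤ A i j) (hArow : ∀ i, ∃ j, A i j ≠ 0)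
    (hAB : ∀ i j, A i j = 0 → B i j = 0) (f g : C_c(KerArrow A B, ℤ)) :
    limitValue hA hB hpf (f + g) = limitValue hA hB hpf f + limitValue hA hB hpf g := by
  obtain ⟨n, x, rfl⟩ := (arrowBasis hA hpf).exists_realize f
  obtain ⟨k, y, rfl⟩ := (arrowBasis hA hpf).exists_realize g
  obtain ⟨x', h1, -⟩ := exists_refine hA hB hpf hA0 hAB (le_max_left n k) x
  obtain ⟨y', h1', -⟩ := exists_refine hA hB hpf hA0 hAB (le_max_right n k) y
  rw [← h1, ← h1', ← map_add]
  simp only [limitValue_realize hA hB hpf hA0 hArow hAB]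
  rw [map_add, map_add]

/-- The homomorphism `1_{Z(α,m,β)} ↦ m φ^B_{n,∞}(1_{r(β)})` for `|α| = |β| = n`. -/
noncomputable def limitHom : C_c(KerArrow A B, ℤ) →+ IndLimit B hB :=
  AddMonoidHom.mk' (limitValue hA hB hpf) (limitValue_add hA hB hpf hA0 hArow hAB)

theorem limitHom_realize {n : ℕ} (x : LTriple A n →₀ ℤ) :
    limitHom hA hB hpf hA0 hArow hAB ((arrowBasis hA hpf).realize n x) =
      toLimit B hB n (vertexSum A n x) :=
  limitValue_realize hA hB hpf hA0 hArow hAB x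

/-- The map `δ₂` on linear combinations of indicator functions. -/
noncomputable def pairBoundary (A : Matrix V V ℤ) (n : ℕ) :
    (LPair A n →₀ ℤ) →ₗ[ℤ] (LTriple A n →₀ ℤ) :=
  Finsupp.linearCombination ℤ fun p =>
    Finsupp.single p.1.2 1 - Finsupp.single p.comp 1 + Finsupp.single p.1.1 1

/-- The three triples attached to a composable pair end at one vertex, with integers `m'`, `m + m'`,
`m`, and `m' - (m + m') + m = 0`. -/
theorem vertexSum_pairBoundary {n : ℕ} (F : LPair A n →₀ ℤ) :
    vertexSum A n (pairBoundary A n F) = 0 := by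
  induction F using Finsupp.induction_linear with
  | zero => simp
  | add F G hF hG => rw [map_add, map_add, hF, hG, add_zero]
  | single p c =>
    have h1 : p.1.1.1.β.tgt = p.1.2.1.β.tgt := by rw [p.2, p.1.2.1.tgt_eq]
    have h2 : p.comp.1.β.tgt = p.1.2.1.β.tgt := rfl
    have h3 : p.comp.1.m = p.1.1.1.m + p.1.2.1.m := rfl
    simp only [pairBoundary, Finsupp.linearCombination_single, map_smul, map_add, map_sub,
      vertexSum, one_smul, h1, h2, h3, Finsupp.single_add]
    abel_nf

theorem δ₂_realize {n : ℕ} (F : LPair A n →₀ ℤ) :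
    (kerGroupoid A B).δ₂ ((pairBasis hA hpf).realize n F) =
      ⇑((arrowBasis hA hpf).realize n (pairBoundary A n F)) := by
  induction F using Finsupp.induction_linear with
  | zero => simp
  | add F G hF hG =>
    simp only [map_add, hF, hG, CompactlySupportedContinuousMap.coe_add]
  | single p c =>
    simp only [LevelBasis.realize_single, pairBoundary, Finsupp.linearCombination_single,
      map_zsmul, δ₂_ind, map_smul, map_add, map_sub, one_smul]
    rfl

theorem limitHom_eq_zero {f : C_c(KerArrow A B, ℤ)}
    (hf : ∃ h, (kerGroupoid A B).δ₂ h = ⇑f) : limitHom hA hB hpf hA0 hArow hAB f = 0 := by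
  obtain ⟨h, hh⟩ := hf
  obtain ⟨n, F, rfl⟩ := (pairBasis hA hpf).exists_realize h
  rw [δ₂_realize] at hh
  rw [← DFunLike.coe_injective hh, limitHom_realize, vertexSum_pairBoundary, map_zero]

/-! ### Relations modulo boundaries -/

variable (A B) in
/-- The functions of the form `δ₂ h`. -/
noncomputable def chainBoundaries : AddSubgroup C_c(KerArrow A B, ℤ) where
  carrier := {f | ∃ h, (kerGroupoid A B).δ₂ h = ⇑f}
  zero_mem' := ⟨0, by simp⟩
  add_mem' := by
    rintro a b ⟨h, hh⟩ ⟨k, hk⟩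
    exact ⟨h + k, by simp [hh, hk]⟩
  neg_mem' := by
    rintro a ⟨h, hh⟩
    exact ⟨-h, by simp [hh]⟩

/-- The class of `1_{Z(α,m,β)}` modulo boundaries. -/
noncomputable def indClass {n : ℕ} (t : LTriple A n) :
    C_c(KerArrow A B, ℤ) ⧸ chainBoundaries A B :=
  QuotientAddGroup.mk ((arrowBasis hA hpf).ind n t)

/-- The indicator of the set of composable pairs has `δ₂` equal to second factor minus product plus
first factor. The individual indicators need not be cycles, hence the quotient of all chains. -/
theorem indClass_comp {n : ℕ} (p : LPair A n) :
    indClass hA hpf p.comp = indClass hA hpf p.1.1 + indClass hA hpf p.1.2 := by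
  refine (QuotientAddGroup.eq (s := chainBoundaries A B)).2 ?_
  refine ⟨(pairBasis hA hpf).ind n p, ?_⟩
  rw [δ₂_ind]
  funext g
  change (arrowBasis hA hpf).ind n p.1.2 g - (arrowBasis hA hpf).ind n p.comp g +
    (arrowBasis hA hpf).ind n p.1.1 g = -(arrowBasis hA hpf).ind n p.comp g +
      ((arrowBasis hA hpf).ind n p.1.1 g + (arrowBasis hA hpf).ind n p.1.2 g)
  ring

theorem indClass_add {n : ℕ} {α β γ : FinPath A} (hα : α.length = n) (hβ : β.length = n)
    (hγ : γ.length = n) (h : α.tgt = β.tgt) (h' : β.tgt = γ.tgt) (m m' : ℤ) :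
    indClass hA hpf ⟨⟨α, m + m', γ, h.trans h'⟩, hα, hγ⟩ =
      indClass hA hpf ⟨⟨α, m, β, h⟩, hα, hβ⟩ + indClass hA hpf ⟨⟨β, m', γ, h'⟩, hβ, hγ⟩ :=
  indClass_comp hA hpf ⟨(⟨⟨α, m, β, h⟩, hα, hβ⟩, ⟨⟨β, m', γ, h'⟩, hβ, hγ⟩), rfl⟩

/-- By `indClass_add` the class is a homomorphism in `m`, so its value at 1 determines it. -/
theorem indClass_diag {n : ℕ} {τ : FinPath A} (hτ : τ.length = n) (m : ℤ) :
    indClass hA hpf ⟨⟨τ, m, τ, rfl⟩, hτ, hτ⟩ = m • indClass hA hpf ⟨⟨τ, 1, τ, rfl⟩, hτ, hτ⟩ := by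
  let f : ℤ →+ C_c(KerArrow A B, ℤ) ⧸ chainBoundaries A B :=
    AddMonoidHom.mk' (fun m => indClass hA hpf ⟨⟨τ, m, τ, rfl⟩, hτ, hτ⟩)
      fun m m' => indClass_add hA hpf hτ hτ hτ rfl rfl m m'
  have h := map_zsmul f m 1
  rwa [smul_eq_mul, mul_one] at h

/-- The triple `(α, m, τ)` factors both as `(α, m, β)(β, 0, τ)` and as `(α, 0, τ)(τ, m, τ)`. -/
theorem indClass_eq {n : ℕ} {α β τ : FinPath A} (hα : α.length = n) (hβ : β.length = n)
    (hτ : τ.length = n) (h : α.tgt = β.tgt) (h' : β.tgt = τ.tgt) (m : ℤ) :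
    indClass hA hpf ⟨⟨α, m, β, h⟩, hα, hβ⟩ =
      indClass hA hpf ⟨⟨α, 0, τ, h.trans h'⟩, hα, hτ⟩ -
        indClass hA hpf ⟨⟨β, 0, τ, h'⟩, hβ, hτ⟩ +
        m • indClass hA hpf ⟨⟨τ, 1, τ, rfl⟩, hτ, hτ⟩ := by
  have h1 := indClass_add hA hpf hα hβ hτ h h' m 0
  have h2 := indClass_add hA hpf hα hτ hτ (h.trans h') rfl 0 m
  rw [indClass_diag hA hpf hτ] at h2
  simp only [add_zero, zero_add] at h1 h2
  rw [h1] at h2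
  rw [sub_add_eq_add_sub, ← h2, add_sub_cancel_right]

/-! ### Cycles and the criterion for being a boundary -/

variable (A) in
/-- The map `1_{Z(α,m,β)} ↦ 1_α - 1_β`. -/
noncomputable def pathBoundary (n : ℕ) :
    (LTriple A n →₀ ℤ) →ₗ[ℤ] ({α : FinPath A // α.length = n} →₀ ℤ) :=
  Finsupp.linearCombination ℤ fun t =>
    Finsupp.single ⟨t.1.α, t.2.1⟩ 1 - Finsupp.single ⟨t.1.β, t.2.2⟩ 1

theorem indicator_Z_eq_single {n : ℕ} {α β : FinPath A} (hα : α.length = n) (hβ : β.length = n)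
    {y : InfPath A} (hy : y ∈ α.Z) : β.Z.indicator (1 : InfPath A → ℤ) y =
      (Finsupp.single ⟨β, hβ⟩ 1 : {α : FinPath A // α.length = n} →₀ ℤ) ⟨α, hα⟩ := by
  classical
  by_cases h : β = α
  · subst h
    simp [hy]
  · have h' : y ∉ β.Z := fun h' => h (FinPath.eq_of_mem h' hy (hβ.trans hα.symm))
    simp [h', h]

/-- Cylinders of paths of length `n` are disjoint, so a point of `Z(α)` reads off the coefficient of
`α`. The sign appears because `δ₁` is source minus range while `pathBoundary` is range path minus
source path. -/
theorem δ₁_realize_apply {n : ℕ} (x : LTriple A n →₀ ℤ) {α : FinPath A} (hα : α.length = n)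
    {y : InfPath A} (hy : y ∈ α.Z) :
    (kerGroupoid A B).δ₁ ((arrowBasis hA hpf).realize n x) y = -pathBoundary A n x ⟨α, hα⟩ := by
  induction x using Finsupp.induction_linear with
  | zero => simp
  | add x x' h h' => simp only [map_add, Pi.add_apply, h, h', Finsupp.add_apply, neg_add]
  | single t c =>
    simp only [LevelBasis.realize_single, map_zsmul, δ₁_ind, pathBoundary,
      Finsupp.linearCombination_single, Pi.smul_apply, Pi.sub_apply, Finsupp.smul_apply,
      Finsupp.sub_apply, indicator_Z_eq_single hα t.2.1 hy, indicator_Z_eq_single hα t.2.2 hy,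
      smul_eq_mul]
    ring

theorem pathBoundary_eq_zero (hA0 : ∀ i j, 0 ≤ A i j) (hArow : ∀ i, ∃ j, A i j ≠ 0) {n : ℕ}
    {x : LTriple A n →₀ ℤ} (hx : (kerGroupoid A B).δ₁ ((arrowBasis hA hpf).realize n x) = 0) :
    pathBoundary A n x = 0 := by
  ext ⟨α, hα⟩
  obtain ⟨y, hy⟩ := α.nonempty_Z hA0 hArow
  have h := δ₁_realize_apply hA hpf x hα hy
  rw [hx] at h
  simpa using h.symm

variable (A) in
theorem exists_basePath (n : ℕ) : ∃ τ : V → FinPath A, ∀ α : FinPath A, α.length = n →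
    (τ α.tgt).length = n ∧ α.tgt = (τ α.tgt).tgt := by
  classical
  refine ⟨fun w => if h : ∃ α : FinPath A, α.length = n ∧ w = α.tgt then h.choose else
    FinPath.vertex A w, fun α hα => ?_⟩
  have h : ∃ α' : FinPath A, α'.length = n ∧ α.tgt = α'.tgt := ⟨α, hα, rfl⟩
  simp only [dif_pos h]
  exact h.choose_spec

/-- Modulo boundaries, a combination of the functions `1_{Z(α,m,β)}` depends only on its images
under `pathBoundary` and `vertexSum`. -/
theorem realize_mem_chainBoundaries {n : ℕ} {x : LTriple A n →₀ ℤ}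
    (h1 : pathBoundary A n x = 0) (h2 : vertexSum A n x = 0) :
    (arrowBasis hA hpf).realize n x ∈ chainBoundaries A B := by
  classical
  obtain ⟨τ, hτ⟩ := exists_basePath A n
  let L : ({α : FinPath A // α.length = n} →₀ ℤ) →ₗ[ℤ]
      C_c(KerArrow A B, ℤ) ⧸ chainBoundaries A B :=
    Finsupp.linearCombination ℤ fun α =>
      indClass hA hpf ⟨⟨α.1, 0, τ α.1.tgt, (hτ α.1 α.2).2⟩, α.2, (hτ α.1 α.2).1⟩
  let M : (V →₀ ℤ) →ₗ[ℤ] C_c(KerArrow A B, ℤ) ⧸ chainBoundaries A B :=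
    Finsupp.linearCombination ℤ fun w =>
      if h : (τ w).length = n then indClass hA hpf ⟨⟨τ w, 1, τ w, rfl⟩, h, h⟩ else 0
  -- On a single triple this is `indClass_eq` with `τ` the base path at `r(β)`: `L` collects the two
  -- terms with integer 0 and `M` the multiple of `(τ, 1, τ)`.
  have key : ∀ x : LTriple A n →₀ ℤ,
      QuotientAddGroup.mk' (chainBoundaries A B) ((arrowBasis hA hpf).realize n x) =
        L (pathBoundary A n x) + M (vertexSum A n x) := by
    intro x
    induction x using Finsupp.induction_linear with
    | zero => simp
    | add x x' h h' =>
      simp only [map_add, h, h']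
      abel
    | single t c =>
      obtain ⟨⟨α, m, β, h⟩, hα, hβ⟩ := t
      have e := indClass_eq hA hpf hα hβ (hτ β hβ).1 h (hτ β hβ).2 m
      have e' : QuotientAddGroup.mk' (chainBoundaries A B) ((arrowBasis hA hpf).ind n
        ⟨⟨α, m, β, h⟩, hα, hβ⟩) = indClass hA hpf ⟨⟨α, m, β, h⟩, hα, hβ⟩ := rfl
      rw [LevelBasis.realize_single, map_zsmul, e', e]
      simp only [L, M, pathBoundary, vertexSum, Finsupp.linearCombination_single, map_smul,
        map_sub, one_smul, dif_pos (hτ β hβ).1, h]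
      exact zsmul_add _ _ _
  have := key x
  rw [h1, h2, map_zero, map_zero, add_zero] at this
  exact (QuotientAddGroup.eq_zero_iff _).1 this

theorem mem_boundaries_of_limitHom_eq_zero (z : (kerGroupoid A B).cycles₁)
    (hz : limitHom hA hB hpf hA0 hArow hAB z = 0) : z ∈ (kerGroupoid A B).boundaries₁ := by
  obtain ⟨n, x, hx⟩ := (arrowBasis hA hpf).exists_realize z.1
  rw [← hx, limitHom_realize] at hz
  -- Zero in the limit means zero at some stage `k`; the cycle is rewritten at level `k`, where its
  -- vertex sum vanishes exactly.
  obtain ⟨k, hk, h0⟩ := exists_pow_eq_zero hB hz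
  obtain ⟨y, hy, hy'⟩ := exists_refine hA hB hpf hA0 hAB hk x
  rw [h0] at hy'
  have hc : (kerGroupoid A B).δ₁ ((arrowBasis hA hpf).realize k y) = 0 := by
    rw [hy, hx]
    exact z.2
  have := realize_mem_chainBoundaries hA hpf (pathBoundary_eq_zero hA hpf hA0 hArow hc) hy'
  rw [hy, hx] at this
  exact this

/-! ### Generators of the inductive limit -/

/-- Deleting the first edge shortens a path without changing its range. -/
theorem FinPath.exists_init {n : ℕ} (α : FinPath A) (hα : α.length = n + 1) :
    ∃ β : FinPath A, β.length = n ∧ β.tgt = α.tgt := by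
  obtain ⟨v, w, l, hl⟩ := α
  cases l with
  | nil => simp [FinPath.length] at hα
  | cons e l => exact ⟨⟨e.tgt, w, l, hl.2⟩, by simpa [FinPath.length] using hα, rfl⟩

variable (A) in
/-- The vertices which are ranges of paths of length `n`. -/
def ranges (n : ℕ) : Set V := {w | ∃ α : FinPath A, α.length = n ∧ α.tgt = w}

theorem ranges_antitone : Antitone (ranges A) := by
  refine antitone_nat_of_succ_le fun n w => ?_
  rintro ⟨α, hα, rfl⟩
  exact α.exists_init hα

/-- For finite `V` the decreasing sequence of sets of ranges stabilises. Without zero columns paths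
extend backwards indefinitely, so every vertex is a range at every length and `K = 0` works. -/
theorem exists_ranges_subset (hA0 : ∀ i j, 0 ≤ A i j) (hsrc : Finite V ∨ ∀ j, ∃ i, A i j ≠ 0) :
    ∃ K, ∀ n, ranges A K ⊆ ranges A (n + K) := by
  rcases hsrc with hV | hcol
  · obtain ⟨K, hK⟩ := WellFoundedGT.monotone_chain_condition
      (⟨fun n => OrderDual.toDual (ranges A n), fun _ _ h => ranges_antitone h⟩ :
        ℕ →o (Set V)ᵒᵈ)
    refine ⟨K, fun n => ?_⟩
    have h : ranges A K = ranges A (n + K) := hK (n + K) (by omega)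
    exact h.le
  · refine ⟨0, fun n w _ => ?_⟩
    induction n generalizing w with
    | zero => exact ⟨FinPath.vertex A w, rfl, rfl⟩
    | succ n ih =>
      obtain ⟨v, hv⟩ := hcol w
      obtain ⟨α, hα, hαv⟩ := ih (w := v) ⟨FinPath.vertex A v, rfl, rfl⟩
      let e : Edge A := ⟨v, w, 0, le_rfl, lt_of_le_of_ne (hA0 _ _) hv.symm⟩
      refine ⟨α.snoc e hαv.symm, ?_, rfl⟩
      rw [FinPath.length_snoc, hα]

/-- A nonzero entry of `B` lies over a nonzero entry of `A`, so each application of the connecting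
map moves along edges of the graph. -/
theorem mem_ranges_of_mem_support (hAB : ∀ i j, A i j = 0 → B i j = 0)
    (hA0 : ∀ i j, 0 ≤ A i j) (k : ℕ) (x : V →₀ ℤ) :
    ∀ w ∈ ((connecting B hB ^ k) x).support, w ∈ ranges A k := by
  induction k with
  | zero => exact fun w _ => ⟨FinPath.vertex A w, rfl, rfl⟩
  | succ k ih =>
    intro w hw
    rw [pow_succ', Module.End.mul_apply, connecting, Finsupp.linearCombination_apply,
      Finsupp.mem_support_iff, Finsupp.sum_apply] at hw
    obtain ⟨v, hv, hvw⟩ := Finset.exists_ne_zero_of_sum_ne_zero hw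
    obtain ⟨α, hα, rfl⟩ := ih v hv
    have hB' : B α.tgt w ≠ 0 := by
      intro h
      exact hvw (by simp [Finsupp.ofSupportFinite_coe, h])
    have hA' : A α.tgt w ≠ 0 := fun h => hB' (hAB _ _ h)
    let e : Edge A := ⟨α.tgt, w, 0, le_rfl, lt_of_le_of_ne (hA0 _ _) hA'.symm⟩
    exact ⟨α.snoc e rfl, by rw [FinPath.length_snoc, hα], rfl⟩

/-- The elements `φ^B_{n,∞}(1_{r(α)})`, `α ∈ E^n`, generate the inductive limit. -/
theorem closure_toLimit_eq_top (hA0 : ∀ i j, 0 ≤ A i j) (hAB : ∀ i j, A i j = 0 → B i j = 0)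
    (hsrc : Finite V ∨ ∀ j, ∃ i, A i j ≠ 0) :
    AddSubgroup.closure (Set.range fun α : FinPath A =>
      toLimit B hB α.length (Finsupp.single α.tgt 1)) = ⊤ := by
  refine (AddSubgroup.eq_top_iff' _).2 fun y => ?_
  obtain ⟨n, x, rfl⟩ := Module.DirectLimit.exists_of y
  obtain ⟨K, hK⟩ := exists_ranges_subset hA0 hsrc
  change toLimit B hB n x ∈ _
  -- Moved `K` stages on, the element is supported on ranges of paths of length `K`, which by the
  -- choice of `K` are also ranges of paths of length `n + K`, the new stage.
  rw [← toLimit_pow hB (Nat.le_add_right n K), Nat.add_sub_cancel_left]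
  have hs := mem_ranges_of_mem_support hB hAB hA0 K x
  generalize (connecting B hB ^ K) x = u at *
  rw [← Finsupp.sum_single u, Finsupp.sum, map_sum]
  refine AddSubgroup.sum_mem _ fun w hw => ?_
  obtain ⟨α, hα, rfl⟩ := hK n (hs w hw)
  rw [← hα, ← Finsupp.smul_single_one, map_smul]
  exact AddSubgroup.zsmul_mem _ (AddSubgroup.subset_closure (Set.mem_range_self α)) _

/-! ### The isomorphism -/

/-- The cycle `1_{Z(α,1,α)}`. -/
noncomputable def diagCycle (α : FinPath A) : (kerGroupoid A B).cycles₁ :=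
  ⟨(arrowBasis hA hpf).ind α.length ⟨⟨α, 1, α, rfl⟩, rfl, rfl⟩, by
    change (kerGroupoid A B).δ₁ _ = 0
    rw [δ₁_ind, sub_self]⟩

/-- The homomorphism `H₁(ℋ_{A,B}) → ℤ_B`. -/
noncomputable def homologyHom : (kerGroupoid A B).H₁ →+ IndLimit B hB :=
  QuotientAddGroup.lift _
    ((limitHom hA hB hpf hA0 hArow hAB).comp (kerGroupoid A B).cycles₁.subtype)
    fun _ hz => limitHom_eq_zero hA hB hpf hA0 hArow hAB hz

theorem homologyHom_diagCycle (α : FinPath A) :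
    homologyHom hA hB hpf hA0 hArow hAB
        ((kerGroupoid A B).homologyClass (diagCycle hA hpf α)) =
      toLimit B hB α.length (Finsupp.single α.tgt 1) := by
  have h := limitHom_realize hA hB hpf hA0 hArow hAB
    (Finsupp.single (⟨⟨α, 1, α, rfl⟩, rfl, rfl⟩ : LTriple A α.length) 1)
  rw [LevelBasis.realize_single, one_smul, vertexSum, Finsupp.linearCombination_single,
    one_smul] at h
  exact h

theorem homologyHom_bijective (hsrc : Finite V ∨ ∀ j, ∃ i, A i j ≠ 0) :
    Function.Bijective (homologyHom hA hB hpf hA0 hArow hAB) := by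
  constructor
  · refine (injective_iff_map_eq_zero _).2 fun c hc => ?_
    obtain ⟨z, rfl⟩ := QuotientAddGroup.mk_surjective c
    exact (QuotientAddGroup.eq_zero_iff z).2
      (mem_boundaries_of_limitHom_eq_zero hA hB hpf hA0 hArow hAB z hc)
  · refine AddMonoidHom.range_eq_top.1 (top_le_iff.1 ?_)
    rw [← closure_toLimit_eq_top hB hA0 hAB hsrc, AddSubgroup.closure_le]
    rintro _ ⟨α, rfl⟩
    exact ⟨_, homologyHom_diagCycle hA hB hpf hA0 hArow hAB α⟩

end

end Katsura

/-! ### The main theorem -/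

theorem mainTheorem3 {V : Type*} [Countable V] (A B : Matrix V V ℤ)
    (hA : ∀ i j, 0 ≤ A i j)
    (hAfin : Katsura.RowFinite A) (hBfin : Katsura.RowFinite B)
    (hArow : ∀ i, ∃ j, A i j ≠ 0) (hBrow : ∀ i, ∃ j, B i j ≠ 0)
    (hAB : ∀ i j, A i j = 0 → B i j = 0)
    (hpf : Katsura.PseudoFree A B)
    (hsrc : Finite V ∨ ∀ j, ∃ i, A i j ≠ 0) :
    ∃! Φ : (Katsura.kerGroupoid A B).H₁ ≃+ Katsura.IndLimit B hBfin,
      ∀ α : Katsura.FinPath A, ∃ z : (Katsura.kerGroupoid A B).cycles₁,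
        ⇑(z : C_c({g : Katsura.Arrow A B // Katsura.Arrow.ρ g = 0}, ℤ)) =
          Set.indicator (Katsura.diagSet A B α 1) 1 ∧
        Φ ((Katsura.kerGroupoid A B).homologyClass z) =
          Katsura.toLimit B hBfin α.length (Finsupp.single α.tgt 1) := by
  refine ⟨AddEquiv.ofBijective _
    (Katsura.homologyHom_bijective hAfin hBfin hpf hA hArow hAB hsrc), fun α =>
      ⟨Katsura.diagCycle hAfin hpf α, rfl,
        Katsura.homologyHom_diagCycle hAfin hBfin hpf hA hArow hAB α⟩, fun Ψ hΨ => ?_⟩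
  -- The known generators lie in the inductive limit, so the inverses are compared on them.
  have h : Ψ.symm.toAddMonoidHom = (AddEquiv.ofBijective _
      (Katsura.homologyHom_bijective hAfin hBfin hpf hA hArow hAB hsrc)).symm.toAddMonoidHom := by
    refine AddMonoidHom.eq_of_eqOn_dense
      (Katsura.closure_toLimit_eq_top (B := B) hBfin hA hAB hsrc) ?_
    rintro _ ⟨α, rfl⟩
    obtain ⟨z, hz, hz'⟩ := hΨ α
    -- A cycle is determined by its underlying function, so the cycle provided for `Ψ` is the
    -- standard one.
    obtain rfl : z = Katsura.diagCycle hAfin hpf α := Subtype.ext (DFunLike.coe_injective hz)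
    have e := Katsura.homologyHom_diagCycle hAfin hBfin hpf hA hArow hAB α
    refine (Ψ.symm_apply_eq.2 hz'.symm).trans ?_
    exact ((AddEquiv.ofBijective _ (Katsura.homologyHom_bijective hAfin hBfin hpf hA hArow hAB
      hsrc)).symm_apply_eq.2 e.symm).symm
  have h' : Ψ.symm = (AddEquiv.ofBijective _
      (Katsura.homologyHom_bijective hAfin hBfin hpf hA hArow hAB hsrc)).symm :=
    AddEquiv.ext fun y => DFunLike.congr_fun h y
  rw [← Ψ.symm_symm, h', AddEquiv.symm_symm]
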